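/- Let $n\ge 0$ be an integer, let $\mathfrak{gl}_n=\mathfrak{gl}_n(\mathbb{C})$ with matrix units $E_{ij}$, and let $X=(x_{ij})_{1\le i,j\le n}$ be a matrix of commuting variables. For $\alpha\in\mathbb{C}$ the $\alpha$-determinant of $X$ is $$\det\nolimits^{(\alpha)}(X)=\sum_{\sigma\in\mathfrak{S}_n}\alpha^{\,n-\nu(\sigma)}\prod_{i=1}^n x_{i\sigma(i)},$$ where $\nu(\sigma)$ is the number of cycles of $\sigma$, fixed points included (and $0^0=1$). The Lie algebra $\mathfrak{gl}_n$ acts on the polynomial ring $\mathbb{C}[x_{ij}]$ by $\rho(E_{ij})=\sum_{k=1}^n x_{ik}\,\partial/\partial x_{jk}$; put $$V_n^{(\alpha)}=\rho(U(\mathfrak{gl}_n))\det\nolimits^{(\alpha)}(X),$$ the cyclic $U(\mathfrak{gl}_n)$-module generated by the $\alpha$-determinant. For a partition $\lambda\vdash n$ with conjugate $\lambda'$, let $f^\lambda$ be the number of standard tableaux of shape $\lambda$, and let $E^\lambda$ be the Schur module of $\mathfrak{gl}_n$, that is, the image of the Young symmetrizer $\sum_{q}\sum_{p}\operatorname{sgn}(q)\,qp$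 of a numbering of the boxes of $\lambda$ ($q$ in its column group, $p$ in its row group), acting by permutation of the tensor factors on $(\mathbb{C}^n)^{\otimes n}$. All isomorphisms below are isomorphisms of $\mathfrak{gl}_n$-modules, and $\mathfrak{gl}_n$ acts on $(\mathbb{C}^n)^{\otimes n}$ by the $n$-th tensor power of its natural representation. For $k=1,2,\dots,n-1$, $$V_n^{(1/k)}\cong\bigoplus_{\lambda\vdash n,\ \lambda_1'\le k}(E^\lambda)^{\oplus f^\lambda}\qquad\text{and}\qquad V_n^{(-1/k)}\cong\bigoplus_{\lambda\vdash n,\ \lambda_1\le k}(E^\lambda)^{\oplus f^\lambda}.$$ For every $\alpha\in\mathbb{C}\setminus\{\pm1,\pm\tfrac12,\dots,\pm\tfrac1{n-1}\}$, $$V_n^{(\alpha)}\cong(\mathbb{C}^n)^{\otimes n}\cong\bigoplus_{\lambda\vdash n}(E^\lambda)^{\oplus f^\lambda}.$$ -/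

import Mathlib

open scoped TensorProduct DirectSum

attribute [local instance 100] LieRing.ofAssociativeRing

namespace AlphaDet

/-- The general linear Lie algebra `𝔤𝔩ₙ(ℂ)`, with the commutator bracket. -/
abbrev gl (n : ℕ) : Type := Matrix (Fin n) (Fin n) ℂ

/-! ### The polynomial representation and the cyclic module -/

/-- The ring of polynomials in the variables `x i j`. -/
abbrev Poly (n : ℕ) : Type := MvPolynomial (Fin n × Fin n) ℂ

/-- The number of cycles of a permutation, fixed points included. -/
def numCycles {n : ℕ} (σ : Equiv.Perm (Fin n)) : ℕ := σ.partition.parts.card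

/-- The `α`-determinant of a square matrix over a commutative `ℂ`-algebra. -/
noncomputable def alphaDet {n : ℕ} {A : Type*} [CommRing A] [Algebra ℂ A] (α : ℂ)
    (M : Matrix (Fin n) (Fin n) A) : A :=
  ∑ σ : Equiv.Perm (Fin n), α ^ (n - numCycles σ) • ∏ i, M i (σ i)

/-- The derivation `∑ᵢⱼ Aᵢⱼ ∑ₖ xᵢₖ ∂ⱼₖ` of the polynomial ring. -/
noncomputable def polyDer {n : ℕ} (A : gl n) : Derivation ℂ (Poly n) (Poly n) :=
  ∑ i, ∑ j, A i j • ∑ k, (MvPolynomial.X (i, k) : Poly n) • MvPolynomial.pderiv (j, k)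

theorem derivation_sum_apply {n : ℕ} (D : Fin n → Derivation ℂ (Poly n) (Poly n)) (p : Poly n) :
    (∑ i, D i) p = ∑ i, D i p := by
  have h := map_sum (Derivation.coeFnAddMonoidHom (R := ℂ) (A := Poly n) (M := Poly n)) D
    Finset.univ
  simp only [Derivation.coeFnAddMonoidHom_apply] at h
  rw [h, Finset.sum_apply]

theorem polyDer_X {n : ℕ} (A : gl n) (a b : Fin n) :
    polyDer A (MvPolynomial.X (a, b)) = ∑ i, A i a • (MvPolynomial.X (i, b) : Poly n) := by
  simp only [polyDer, derivation_sum_apply, Derivation.coe_smul, Pi.smul_apply,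
    MvPolynomial.pderiv_X, smul_eq_mul]
  refine Finset.sum_congr rfl fun i _ => ?_
  rw [Finset.sum_eq_single a]
  · congr 1
    rw [Finset.sum_eq_single b]
    · simp
    · intro k _ hk
      simp [hk.symm]
    · simp
  · intro j _ hj
    rw [Finset.sum_eq_zero, smul_zero]
    intro k _
    simp [hj.symm]
  · simp

/-- The representation `ρ` of `𝔤𝔩ₙ(ℂ)` on polynomials, `ρ(Eᵢⱼ) = ∑ₖ xᵢₖ ∂ⱼₖ`. -/
noncomputable def rho (n : ℕ) : gl n →ₗ⁅ℂ⁆ Module.End ℂ (Poly n) where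
  toFun A := (polyDer A : Poly n →ₗ[ℂ] Poly n)
  map_add' A B := by
    rw [← Derivation.coe_add_linearMap]
    congr 1
    refine MvPolynomial.derivation_ext fun ⟨a, b⟩ => ?_
    simp [polyDer_X, add_smul, Finset.sum_add_distrib]
  map_smul' c A := by
    rw [RingHom.id_apply, ← Derivation.coe_smul_linearMap]
    congr 1
    refine MvPolynomial.derivation_ext fun ⟨a, b⟩ => ?_
    simp [polyDer_X, mul_smul, Finset.smul_sum]
  map_lie' := by
    intro A B
    have h : polyDer ⁅A, B⁆ = ⁅polyDer A, polyDer B⁆ := by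
      refine MvPolynomial.derivation_ext fun ⟨a, b⟩ => ?_
      simp only [Derivation.commutator_apply, polyDer_X, map_sum, Derivation.map_smul,
        Finset.smul_sum, smul_smul, Ring.lie_def, Matrix.sub_apply, Matrix.mul_apply, sub_smul,
        Finset.sum_sub_distrib, Finset.sum_smul]
      congr 1
      · rw [Finset.sum_comm]
        exact Finset.sum_congr rfl fun i _ => Finset.sum_congr rfl fun j _ => by rw [mul_comm]
      · rw [Finset.sum_comm]
        exact Finset.sum_congr rfl fun i _ => Finset.sum_congr rfl fun j _ => by rw [mul_comm]
    rw [h]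
    ext1 p
    rfl

noncomputable instance (n : ℕ) : LieRingModule (gl n) (Poly n) :=
  LieRingModule.compLieHom (Poly n) (rho n)

instance (n : ℕ) : LieModule ℂ (gl n) (Poly n) :=
  LieModule.compLieHom (Poly n) (rho n)

/-- The cyclic module `V_n^{(α)} = ρ(U(𝔤𝔩ₙ)) det^{(α)}(X)`, where `X = (x i j)`. -/
noncomputable def cyclicModule (n : ℕ) (α : ℂ) : LieSubmodule ℂ (gl n) (Poly n) where
  carrier := {p | ∃ u : UniversalEnvelopingAlgebra ℂ (gl n),
    UniversalEnvelopingAlgebra.lift ℂ (rho n) u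
      (alphaDet α (Matrix.mvPolynomialX (Fin n) (Fin n) ℂ)) = p}
  add_mem' := by
    rintro _ _ ⟨u, rfl⟩ ⟨v, rfl⟩
    exact ⟨u + v, by simp⟩
  zero_mem' := ⟨0, by simp⟩
  smul_mem' := by
    rintro c _ ⟨u, rfl⟩
    exact ⟨c • u, by simp⟩
  lie_mem := by
    rintro A _ ⟨u, rfl⟩
    refine ⟨UniversalEnvelopingAlgebra.ι ℂ A * u, ?_⟩
    rw [map_mul, UniversalEnvelopingAlgebra.lift_ι_apply]
    rfl

/-! ### Tensor powers of the natural representation -/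

/-- The tensor power of `ℂⁿ` with factors indexed by `ι`. -/
abbrev Tensor (n : ℕ) (ι : Type) : Type := ⨂[ℂ] _ : ι, (Fin n → ℂ)

theorem commutator_sum {R ι : Type*} [Ring R] [Fintype ι] [DecidableEq ι] (a b c : ι → R)
    (h : ∀ k, c k + b k * a k = a k * b k) (hc : ∀ k l, k ≠ l → a k * b l = b l * a k) :
    ∑ k, c k = ⁅∑ k, a k, ∑ k, b k⁆ := by
  rw [Ring.lie_def, Finset.sum_mul_sum, Finset.sum_mul_sum,
    Finset.sum_comm (f := fun i j => b i * a j), ← Finset.sum_sub_distrib]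
  refine Finset.sum_congr rfl fun k _ => ?_
  rw [← Finset.sum_sub_distrib, Finset.sum_eq_single k]
  · exact eq_sub_of_add_eq (h k)
  · exact fun l _ hl => sub_eq_zero.mpr (hc k l hl.symm)
  · simp

/-- The action of `𝔤𝔩ₙ(ℂ)` on a tensor power of `ℂⁿ`: the matrix `A` acts as
`∑ₖ 1 ⊗ ⋯ ⊗ A ⊗ ⋯ ⊗ 1`, with `A` in the place `k`. -/
noncomputable def tensorRep (n : ℕ) (ι : Type) [Fintype ι] [DecidableEq ι] :
    gl n →ₗ⁅ℂ⁆ Module.End ℂ (Tensor n ι) where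
  toFun A := ∑ k : ι, PiTensorProduct.map
    (Pi.mulSingle k (Matrix.toLin' A) : ι → Module.End ℂ (Fin n → ℂ))
  map_add' A B := by
    rw [← Finset.sum_add_distrib]
    refine Finset.sum_congr rfl fun k _ => ?_
    rw [map_add]
    exact PiTensorProduct.map_update_add _ k _ _
  map_smul' c A := by
    rw [RingHom.id_apply, Finset.smul_sum]
    refine Finset.sum_congr rfl fun k _ => ?_
    rw [map_smul]
    exact PiTensorProduct.map_update_smul _ k _ _
  map_lie' := by
    intro A B
    refine commutator_sum (R := Module.End ℂ (Tensor n ι)) (ι := ι)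
      (fun k => PiTensorProduct.map (Pi.mulSingle k (Matrix.toLin' A)))
      (fun k => PiTensorProduct.map (Pi.mulSingle k (Matrix.toLin' B)))
      (fun k => PiTensorProduct.map (Pi.mulSingle k (Matrix.toLin' ⁅A, B⁆))) (fun k => ?_) (fun k l hkl => ?_)
    · rw [← PiTensorProduct.map_mul, ← PiTensorProduct.map_mul]
      have h1 := Pi.mulSingle_mul (f := fun _ : ι => Module.End ℂ (Fin n → ℂ)) k
        (Matrix.toLin' A) (Matrix.toLin' B)
      have h2 := Pi.mulSingle_mul (f := fun _ : ι => Module.End ℂ (Fin n → ℂ)) k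
        (Matrix.toLin' B) (Matrix.toLin' A)
      have h3 : ∀ M N : gl n, Matrix.toLin' M * Matrix.toLin' N = Matrix.toLin' (M * N) :=
        fun M N => (Matrix.toLin'_mul M N).symm
      rw [h3] at h1 h2
      refine Eq.trans ?_ (congrArg PiTensorProduct.map h1)
      refine Eq.trans (congrArg (_ + ·) (congrArg PiTensorProduct.map h2.symm)) ?_
      refine (PiTensorProduct.map_update_add _ k _ _).symm.trans ?_
      rw [← map_add, Ring.lie_def, sub_add_cancel]
      rfl
    · rw [← PiTensorProduct.map_mul, ← PiTensorProduct.map_mul]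
      congr 1
      exact Pi.mulSingle_commute hkl _ _

noncomputable instance (n : ℕ) (ι : Type) [Fintype ι] [DecidableEq ι] :
    LieRingModule (gl n) (Tensor n ι) :=
  LieRingModule.compLieHom (Tensor n ι) (tensorRep n ι)

instance (n : ℕ) (ι : Type) [Fintype ι] [DecidableEq ι] : LieModule ℂ (gl n) (Tensor n ι) :=
  LieModule.compLieHom (Tensor n ι) (tensorRep n ι)

/-! ### Partitions, tableaux and Schur modules -/

/-- The permutations of the boxes of `μ` that preserve every row. -/
def rowGroup (μ : YoungDiagram) : Finset (Equiv.Perm μ.cells) :=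
  {p | ∀ c, (p c : ℕ × ℕ).1 = (c : ℕ × ℕ).1}

/-- The permutations of the boxes of `μ` that preserve every column. -/
def colGroup (μ : YoungDiagram) : Finset (Equiv.Perm μ.cells) :=
  {q | ∀ c, (q c : ℕ × ℕ).2 = (c : ℕ × ℕ).2}

/-- The right action of permutations on tensors by permuting the places:
`(⊗ₖ vₖ) · σ = ⊗ₖ v_{σ(k)}`. -/
noncomputable def permute (n : ℕ) {ι : Type} (σ : Equiv.Perm ι) : Tensor n ι →ₗ[ℂ] Tensor n ι :=
  (PiTensorProduct.reindex ℂ (fun _ : ι => (Fin n → ℂ)) σ.symm).toLinearMap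

theorem permute_tprod (n : ℕ) {ι : Type} (σ : Equiv.Perm ι) (v : ι → Fin n → ℂ) :
    permute n σ (PiTensorProduct.tprod ℂ v) = PiTensorProduct.tprod ℂ (fun k => v (σ k)) :=
  PiTensorProduct.reindex_tprod σ.symm v

theorem permute_tensorRep (n : ℕ) {ι : Type} [Fintype ι] [DecidableEq ι] (σ : Equiv.Perm ι)
    (A : gl n) (t : Tensor n ι) :
    permute n σ (tensorRep n ι A t) = tensorRep n ι A (permute n σ t) := by
  suffices h : permute n σ ∘ₗ tensorRep n ι A = tensorRep n ι A ∘ₗ permute n σ from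
    LinearMap.congr_fun h t
  refine PiTensorProduct.ext (MultilinearMap.ext fun v => ?_)
  change permute n σ ((∑ k, PiTensorProduct.map (Pi.mulSingle k (Matrix.toLin' A)))
      (PiTensorProduct.tprod ℂ v)) = (∑ k, PiTensorProduct.map (Pi.mulSingle k (Matrix.toLin' A)))
      (permute n σ (PiTensorProduct.tprod ℂ v))
  rw [permute_tprod, LinearMap.sum_apply, LinearMap.sum_apply, map_sum]
  simp only [PiTensorProduct.map_tprod, permute_tprod]
  refine (Equiv.sum_comp σ _).symm.trans (Finset.sum_congr rfl fun k _ => ?_)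
  congr 1
  funext l
  by_cases h : l = k
  · subst h; simp
  · rw [Pi.mulSingle_eq_of_ne h, Pi.mulSingle_eq_of_ne (σ.injective.ne h)]

/-- Right multiplication by the Young symmetrizer `∑_q ∑_p sgn(q) q p`, with `q` in the column group
and `p` in the row group, on the tensor power of `ℂⁿ` with factors indexed by the boxes of `μ`. -/
noncomputable def youngSymmetrizer (n : ℕ) (μ : YoungDiagram) :
    Tensor n μ.cells →ₗ[ℂ] Tensor n μ.cells :=
  ∑ q ∈ colGroup μ, ∑ p ∈ rowGroup μ, ((Equiv.Perm.sign q : ℤ) : ℂ) • permute n (q * p)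

/-- The Schur module `E^μ` of `𝔤𝔩ₙ(ℂ)`: the image of the Young symmetrizer. Indexing the tensor
factors by the boxes of `μ` avoids the choice of a numbering of the boxes. -/
noncomputable def schurModule (n : ℕ) (μ : YoungDiagram) :
    LieSubmodule ℂ (gl n) (Tensor n μ.cells) where
  toSubmodule := LinearMap.range (youngSymmetrizer n μ)
  lie_mem := by
    rintro A _ ⟨t, rfl⟩
    refine ⟨tensorRep n μ.cells A t, ?_⟩
    change _ = tensorRep n μ.cells A _
    simp only [youngSymmetrizer, LinearMap.sum_apply, LinearMap.smul_apply, map_sum, map_smul,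
      permute_tensorRep]

/-- The standard tableaux of shape `μ`: the numberings of the boxes by `0, …, |μ| - 1` that strictly
increase along the rows and down the columns. -/
def StandardTableau (μ : YoungDiagram) : Type :=
  {T : μ.cells ≃ Fin μ.card //
    (∀ c d : μ.cells, (c : ℕ × ℕ).1 = (d : ℕ × ℕ).1 → (c : ℕ × ℕ).2 < (d : ℕ × ℕ).2 → T c < T d) ∧
    (∀ c d : μ.cells, (c : ℕ × ℕ).2 = (d : ℕ × ℕ).2 → (c : ℕ × ℕ).1 < (d : ℕ × ℕ).1 → T c < T d)}

/-- The number `f^μ` of standard tableaux of shape `μ`. -/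
noncomputable def numStandard (μ : YoungDiagram) : ℕ := Nat.card (StandardTableau μ)

/-- The direct sum of the modules `(E^μ)^{⊕ f^μ}` over the partitions `μ` of `n` that satisfy `P`. -/
abbrev schurSum (n : ℕ) (P : YoungDiagram → Prop) : Type :=
  ⨁ μ : {μ : YoungDiagram // μ.card = n ∧ P μ}, ⨁ _ : Fin (numStandard μ.1), schurModule n μ.1

end AlphaDet

/-!
Reading the variables of column `j` as the basis vectors of the `j`-th tensor factor embeds
`(ℂⁿ)^{⊗n}` into the polynomials. The `α`-determinant is the image of `a_α · (e₁ ⊗ ⋯ ⊗ eₙ)`, where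
`a_α = ∑_σ α^{n - ν(σ)} σ` is central in the group algebra of the symmetric group. As
`e₁ ⊗ ⋯ ⊗ eₙ` generates the tensors, `V_n^{(α)}` is isomorphic to the image of `a_α`.

The Young symmetrizers of the standard tableaux split the group algebra into a direct sum of right
ideals: a triangularity argument gives independence, and `∑_λ (f^λ)² = n!` gives completeness. So it
remains to see which Young symmetrizers `a_α` annihilates and which it divides.

The Jucys–Murphy factorization `a_α = ∏_k (1 + α J_k)`, where the eigenvalues of `J_k` are integers
of absolute value less than `n`, shows that `a_α` is invertible for generic `α`. For `α = ± 1 / k`,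
counting the colorings of `{1, …, n}` by `k` colors that are invariant under a permutation shows
that `kⁿ a_α` is the sum, over all colorings, of the symmetrizers (antisymmetrizers if `α < 0`) of
the color classes. By the pigeonhole principle every summand kills a Young symmetrizer with a column
(row) longer than `k`. On the other Young symmetrizers the product is injective, because the
summands are positive semidefinite and the rows (columns) of the tableau form one of the colorings.
-/

namespace AlphaDet

open Equiv MonoidAlgebra

/-! ### Signed subgroup sums in a group algebra -/

section SignedSum

variable {R G : Type*} [Ring R] [Group G] [Fintype G] {χ ψ : G →* ℤˣ} {H K : Subgroup G} {τ : G}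

open Classical in
/-- The sum of `χ(h) h` over the elements `h` of the subgroup `H`. Taking the character to be
`ℤˣ`-valued covers both symmetrizers (`χ = 1`) and antisymmetrizers (`χ = sign`). -/
noncomputable def signedSum (χ : G →* ℤˣ) (H : Subgroup G) : MonoidAlgebra R G :=
  ∑ h : G with h ∈ H, χ h • single h 1

theorem single_mul_signedSum (hτ : τ ∈ H) :
    single τ 1 * signedSum χ H = χ τ • (signedSum χ H : MonoidAlgebra R G) := by
  rw [signedSum, Finset.mul_sum, Finset.smul_sum]
  refine Finset.sum_equiv (Equiv.mulLeft τ) (fun h => ?_) fun h _ => ?_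
  · simp [H.mul_mem_cancel_left hτ]
  · rw [mul_smul_comm, single_mul_single, one_mul, smul_smul, coe_mulLeft, map_mul, ← mul_assoc,
      Int.units_mul_self, one_mul]

theorem signedSum_mul_single (hτ : τ ∈ H) :
    signedSum χ H * single τ 1 = χ τ • (signedSum χ H : MonoidAlgebra R G) := by
  rw [signedSum, Finset.sum_mul, Finset.smul_sum]
  refine Finset.sum_equiv (Equiv.mulRight τ) (fun h => ?_) fun h _ => ?_
  · simp [H.mul_mem_cancel_right hτ]
  · rw [smul_mul_assoc, single_mul_single, one_mul, smul_smul, coe_mulRight, map_mul, mul_comm,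
      mul_assoc, Int.units_mul_self, mul_one]

theorem signedSum_mul_self :
    signedSum χ H * signedSum χ H = Nat.card H • (signedSum χ H : MonoidAlgebra R G) := by
  classical
  conv_lhs => enter [1]; rw [signedSum]
  rw [Finset.sum_mul, Nat.card_eq_fintype_card, Fintype.card_subtype, ← Finset.sum_const]
  refine Finset.sum_congr rfl fun h hh => ?_
  rw [smul_mul_assoc, single_mul_signedSum (by simpa using hh), smul_smul, Int.units_mul_self,
    one_smul]

theorem single_mul_signedSum_of_conj (h : ∀ σ, σ ∈ K ↔ τ * σ * τ⁻¹ ∈ H) :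
    single τ 1 * signedSum χ K = (signedSum χ H : MonoidAlgebra R G) * single τ 1 := by
  rw [signedSum, signedSum, Finset.mul_sum, Finset.sum_mul]
  refine Finset.sum_equiv (MulAut.conj τ).toEquiv (fun σ => ?_) fun σ _ => ?_
  · simp [h σ]
  · simp only [MulEquiv.toEquiv_eq_coe, EquivLike.coe_coe, MulAut.conj_apply, map_mul, map_inv,
      mul_inv_cancel_comm, mul_smul_comm, smul_mul_assoc, single_mul_single, mul_one,
      inv_mul_cancel_right]

theorem signedSum_mul_signedSum_eq_zero [IsAddTorsionFree R] (hH : τ ∈ H) (hK : τ ∈ K)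
    (hτ : χ τ = -ψ τ) : (signedSum χ H : MonoidAlgebra R G) * signedSum ψ K = 0 := by
  have insert_τ : χ τ • ((signedSum χ H : MonoidAlgebra R G) * signedSum ψ K)
      = ψ τ • (signedSum χ H * signedSum ψ K) := by
    rw [← smul_mul_assoc, ← signedSum_mul_single hH, mul_assoc, single_mul_signedSum hK,
      mul_smul_comm]
  have : IsAddTorsionFree (MonoidAlgebra R G) :=
    coeff_injective.isAddTorsionFree (coeffAddEquiv : MonoidAlgebra R G ≃+ _).toAddMonoidHom
  rw [hτ, Units.neg_smul, neg_eq_self] at insert_τ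
  exact (smul_eq_zero_iff_eq _).mp insert_τ

open Classical in
theorem coeff_signedSum (g : G) :
    (signedSum χ H : MonoidAlgebra R G).coeff g = if g ∈ H then χ g • 1 else 0 := by
  simp only [signedSum, coeff_sum, Finsupp.finsetSum_apply, Units.smul_def, coeff_smul,
    coeff_single, Finsupp.smul_apply, Finsupp.single_apply, smul_ite, smul_zero, Finset.sum_ite_eq',
    Finset.mem_filter, Finset.mem_univ, true_and]

theorem coeff_one_signedSum_mul_signedSum (hHK : Disjoint H K) :
    ((signedSum χ H : MonoidAlgebra R G) * signedSum ψ K).coeff 1 = 1 := by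
  classical
  have coeff_term (h : G) : ((χ h • single h 1 : MonoidAlgebra R G) * signedSum ψ K).coeff 1
      = if h ∈ K then (χ h * ψ h) • 1 else 0 := by
    rw [smul_mul_assoc, Units.smul_def, coeff_smul, Finsupp.smul_apply, ← Units.smul_def,
      coeff_single_mul_apply, one_mul, mul_one, coeff_signedSum, inv_mem_iff, smul_ite, smul_zero,
      smul_smul, map_inv, Int.units_inv_eq_self]
  rw [signedSum, Finset.sum_mul, coeff_sum, Finsupp.finsetSum_apply, Finset.sum_eq_single 1]
  · rw [coeff_term, if_pos K.one_mem, map_one, map_one, one_mul, one_smul]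
  · intro h hH h1
    rw [coeff_term, if_neg fun hK => h1 (Subgroup.disjoint_def.mp hHK (by simpa using hH) hK)]
  · simp

theorem signedSum_mul_signedSum_ne_zero [Nontrivial R] (hHK : Disjoint H K) :
    (signedSum χ H : MonoidAlgebra R G) * signedSum ψ K ≠ 0 := by
  intro h
  simpa [h] using coeff_one_signedSum_mul_signedSum (R := R) (χ := χ) (ψ := ψ) hHK

end SignedSum

section CoeffInner

variable {𝕜 G : Type*} [RCLike 𝕜] [Fintype G] {x y : MonoidAlgebra 𝕜 G}

open scoped ComplexOrder

/-- The inner product on a group algebra for which the group elements are orthonormal. Signed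
subgroup sums act by positive operators with respect to it. -/
noncomputable def coeffInner : MonoidAlgebra 𝕜 G →ₗ⋆[𝕜] MonoidAlgebra 𝕜 G →ₗ[𝕜] 𝕜 :=
  LinearMap.mk₂'ₛₗ (starRingEnd 𝕜) (RingHom.id 𝕜) (fun x y => star ⇑x.coeff ⬝ᵥ ⇑y.coeff)
    (by simp [add_dotProduct]) (by simp [smul_dotProduct]) (by simp [dotProduct_add])
    (by simp [dotProduct_smul])

theorem coeffInner_apply (x y : MonoidAlgebra 𝕜 G) :
    coeffInner x y = star ⇑x.coeff ⬝ᵥ ⇑y.coeff :=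
  rfl

theorem coeffInner_self_nonneg : 0 ≤ coeffInner x x :=
  dotProduct_star_self_nonneg _

theorem coeffInner_self_eq_zero : coeffInner x x = 0 ↔ x = 0 := by
  rw [coeffInner_apply, dotProduct_star_self_eq_zero, ← Finsupp.coe_zero, DFunLike.coe_fn_eq,
    coeff_eq_zero]

variable [Group G] {χ ψ : G →* ℤˣ} {H K : Subgroup G}

theorem coeffInner_single_mul (g : G) :
    coeffInner (single g 1 * x) y = coeffInner x (single g⁻¹ 1 * y) := by
  simp only [coeffInner_apply, dotProduct, Pi.star_apply, coeff_single_mul_apply, one_mul, inv_inv]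
  exact Fintype.sum_equiv (Equiv.mulLeft g⁻¹) _ _ fun h => by simp

theorem coeffInner_signedSum_mul :
    coeffInner (signedSum χ H * x) y = coeffInner x (signedSum χ H * y) := by
  simp only [signedSum, Finset.sum_mul, smul_mul_assoc, Units.smul_def, map_sum, map_zsmul,
    LinearMap.sum_apply, LinearMap.smul_apply, coeffInner_single_mul]
  exact Finset.sum_equiv (Equiv.inv G) (by simp) (by simp)

theorem card_nsmul_coeffInner_signedSum_mul :
    Nat.card H • coeffInner x (signedSum χ H * x)
      = coeffInner (signedSum χ H * x) (signedSum χ H * x) := by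
  rw [coeffInner_signedSum_mul, ← mul_assoc, signedSum_mul_self, smul_mul_assoc, map_nsmul]

theorem coeffInner_signedSum_mul_nonneg : 0 ≤ coeffInner x (signedSum χ H * x) := by
  have h : coeffInner x (signedSum χ H * x)
      = (Nat.card H : 𝕜)⁻¹ * coeffInner (signedSum χ H * x) (signedSum χ H * x) := by
    rw [← card_nsmul_coeffInner_signedSum_mul, nsmul_eq_mul,
      inv_mul_cancel_left₀ (Nat.cast_ne_zero.mpr Nat.card_pos.ne')]
  rw [h]
  exact mul_nonneg (inv_nonneg.mpr (Nat.cast_nonneg _)) coeffInner_self_nonneg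

theorem signedSum_mul_eq_zero_of_coeffInner_eq_zero (h : coeffInner x (signedSum χ H * x) = 0) :
    signedSum χ H * x = 0 := by
  rw [← coeffInner_self_eq_zero, ← card_nsmul_coeffInner_signedSum_mul, h, smul_zero]

theorem signedSum_mul_eq_zero_of_sum_mul_eq_zero {κ : Type*} {s : Finset κ} {H : κ → Subgroup G}
    (h : (∑ k ∈ s, signedSum χ (H k)) * x = 0) : ∀ k ∈ s, signedSum χ (H k) * x = 0 := by
  have sum_inner : ∑ k ∈ s, coeffInner x (signedSum χ (H k) * x) = 0 := by
    rw [← map_sum, ← Finset.sum_mul, h, map_zero]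
  rw [Finset.sum_eq_zero_iff_of_nonneg fun _ _ => coeffInner_signedSum_mul_nonneg] at sum_inner
  exact fun k hk => signedSum_mul_eq_zero_of_coeffInner_eq_zero (sum_inner k hk)

theorem signedSum_mul_signedSum_mul_eq_zero
    (h : signedSum χ H * (signedSum ψ K * (signedSum χ H * x)) = 0) :
    signedSum ψ K * (signedSum χ H * x) = 0 :=
  signedSum_mul_eq_zero_of_coeffInner_eq_zero (by rw [coeffInner_signedSum_mul, h, map_zero])

end CoeffInner

section FiberStabilizer

variable {ι β γ : Type*} {f : ι → β} {g : ι → γ}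

/-- The permutations that map every fiber of `f` to itself. -/
def fiberStabilizer (f : ι → β) : Subgroup (Perm ι) where
  carrier := {σ | ∀ i, f (σ i) = f i}
  mul_mem' hσ hτ i := (hσ _).trans (hτ i)
  one_mem' _ := rfl
  inv_mem' {σ} hσ i := by simpa using (hσ (σ⁻¹ i)).symm

theorem mem_fiberStabilizer {σ : Perm ι} : σ ∈ fiberStabilizer f ↔ ∀ i, f (σ i) = f i :=
  Iff.rfl

theorem swap_mem_fiberStabilizer [DecidableEq ι] {i j : ι} (hij : f i = f j) :
    swap i j ∈ fiberStabilizer f := fun k => by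
  rw [swap_apply_def]
  split_ifs with hi hj
  · rw [hi, hij]
  · rw [hj, hij]
  · rfl

theorem fiberStabilizer_comp_of_injective {e : β → γ} (he : e.Injective) :
    fiberStabilizer (e ∘ f) = fiberStabilizer f := by
  ext σ
  simp [mem_fiberStabilizer, he.eq_iff]

theorem mem_fiberStabilizer_comp_perm {σ τ : Perm ι} :
    σ ∈ fiberStabilizer (f ∘ τ) ↔ τ * σ * τ⁻¹ ∈ fiberStabilizer f :=
  ⟨fun h i => by simpa using h (τ⁻¹ i), fun h i => by simpa using h (τ i)⟩

theorem disjoint_fiberStabilizer (h : ∀ i j, f i = f j → g i = g j → i = j) :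
    Disjoint (fiberStabilizer f) (fiberStabilizer g) :=
  Subgroup.disjoint_def.mpr fun hσf hσg => Perm.ext fun i => h _ _ (hσf i) (hσg i)

theorem signedSum_fiberStabilizer_mul_eq_zero {R : Type*} [Ring R] [IsAddTorsionFree R] [Fintype ι]
    [DecidableEq ι] {χ ψ : Perm ι →* ℤˣ} {i j : ι} (hf : f i = f j) (hg : g i = g j)
    (h : χ (swap i j) = -ψ (swap i j)) :
    (signedSum χ (fiberStabilizer f) : MonoidAlgebra R (Perm ι))
      * signedSum ψ (fiberStabilizer g) = 0 :=
  signedSum_mul_signedSum_eq_zero (swap_mem_fiberStabilizer hf) (swap_mem_fiberStabilizer hg) h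

end FiberStabilizer

/-! ### Numbers of cycles -/

section Cycles

variable {ι κ : Type*} {σ : Perm ι}

theorem card_factorsThrough {γ : Type*} {g : ι → γ} (hg : g.Surjective) :
    Nat.card {f : ι → κ // f.FactorsThrough g} = Nat.card (γ → κ) := by
  refine (Nat.card_eq_of_bijective
    (fun h : γ → κ => ⟨h ∘ g, fun _ _ hij => congrArg h hij⟩) ⟨fun h h' hh => ?_, fun f => ?_⟩).symm
  · exact hg.injective_comp_right (congrArg Subtype.val hh)
  · exact ⟨f.1 ∘ Function.surjInv hg,
      Subtype.ext (funext fun i => f.2 (Function.surjInv_eq hg (g i)))⟩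

variable [DecidableEq ι]

theorem mul_swap_mem_fiberStabilizer_iff {f : ι → κ} {i m : ι} (hm : σ m = m) :
    σ * swap i m ∈ fiberStabilizer f ↔ σ ∈ fiberStabilizer f ∧ f i = f m := by
  refine ⟨fun h => ?_, fun h => mul_mem h.1 (swap_mem_fiberStabilizer h.2)⟩
  have him : f i = f m := by
    simpa [hm, eq_comm] using mem_fiberStabilizer.mp h i
  exact ⟨(Subgroup.mul_mem_cancel_right _ (swap_mem_fiberStabilizer him)).mp h, him⟩

theorem update_mem_fiberStabilizer {f : ι → κ} {m : ι} (hm : σ m = m)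
    (hσ : σ ∈ fiberStabilizer f) (x : κ) : σ ∈ fiberStabilizer (Function.update f m x) := by
  refine mem_fiberStabilizer.mpr fun j => ?_
  have hj : σ j = m ↔ j = m := ⟨fun h => σ.injective (h.trans hm.symm), fun h => h ▸ hm⟩
  simp only [Function.update_apply, hj, mem_fiberStabilizer.mp hσ j]

/-- A function invariant under `σ` is free in its value at a fixed point `m`; the remaining values
are those of a function invariant under `σ * swap i m`. -/
def invariantFunEquivProd (κ : Type*) {i m : ι} (hm : σ m = m) (him : i ≠ m) :
    {f : ι → κ // σ ∈ fiberStabilizer f} ≃ {f : ι → κ // σ * swap i m ∈ fiberStabilizer f} × κ where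
  toFun f := (⟨Function.update f.1 m (f.1 i), (mul_swap_mem_fiberStabilizer_iff hm).mpr
    ⟨update_mem_fiberStabilizer hm f.2 _, by simp [him]⟩⟩, f.1 m)
  invFun g := ⟨Function.update g.1.1 m g.2,
    update_mem_fiberStabilizer hm ((mul_swap_mem_fiberStabilizer_iff hm).mp g.1.2).1 _⟩
  left_inv f := by simp
  right_inv g := by
    have hg := ((mul_swap_mem_fiberStabilizer_iff hm).mp g.1.2).2
    exact Prod.ext (Subtype.ext (by simp [him, hg])) (by simp)

variable [Fintype ι]

/-- The cycle of `σ` through `i`, where a fixed point counts as a cycle on its own. -/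
def cycleThrough (σ : Perm ι) (i : ι) : σ.cycleFactorsFinset ⊕ {i // i ∉ σ.support} :=
  if hi : i ∈ σ.support then .inl ⟨σ.cycleOf i, Perm.cycleOf_mem_cycleFactorsFinset_iff.mpr hi⟩
  else .inr ⟨i, hi⟩

theorem cycleThrough_surjective (σ : Perm ι) : Function.Surjective (cycleThrough σ) := by
  rintro (⟨c, hc⟩ | ⟨i, hi⟩)
  · obtain ⟨i, hi⟩ := (Perm.mem_cycleFactorsFinset_iff.mp hc).1.nonempty_support
    have hiσ : i ∈ σ.support := Perm.mem_cycleFactorsFinset_support_le hc hi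
    exact ⟨i, by simp [cycleThrough, hiσ, ← Perm.cycle_is_cycleOf hi hc]⟩
  · exact ⟨i, by simp [cycleThrough, hi]⟩

theorem cycleThrough_eq_iff {i j : ι} :
    cycleThrough σ i = cycleThrough σ j ↔ σ.SameCycle i j := by
  constructor
  · intro h
    by_cases hi : i ∈ σ.support <;> by_cases hj : j ∈ σ.support <;>
      simp only [cycleThrough, hi, hj, dite_true, dite_false, reduceCtorEq, Sum.inl.injEq,
        Sum.inr.injEq, Subtype.mk.injEq] at h
    · exact (Perm.sameCycle_iff_cycleOf_eq_of_mem_support hi hj).mpr h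
    · exact h ▸ .rfl
  · intro h
    have hij : i ∈ σ.support ↔ j ∈ σ.support := by
      simpa only [Perm.mem_support, ne_eq, not_iff_not] using h.apply_eq_self_iff
    by_cases hi : i ∈ σ.support
    · simp [cycleThrough, hi, hij.mp hi, h.cycleOf_eq]
    · simp [cycleThrough, mt hij.mpr hi, h.eq_of_left (Perm.notMem_support.mp hi)]

theorem mem_fiberStabilizer_iff_factorsThrough {f : ι → κ} :
    σ ∈ fiberStabilizer f ↔ f.FactorsThrough (cycleThrough σ) := by
  constructor
  · intro hσ i j hij
    obtain ⟨z, rfl⟩ := cycleThrough_eq_iff.mp hij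
    exact (mem_fiberStabilizer.mp (zpow_mem hσ z) i).symm
  · exact fun h => mem_fiberStabilizer.mpr fun i => h (cycleThrough_eq_iff.mpr
      (Perm.sameCycle_apply_left.mpr (Perm.SameCycle.refl σ i)))

theorem card_invariant_fun (σ : Perm ι) (κ : Type*) :
    Nat.card {f : ι → κ // σ ∈ fiberStabilizer f} = Nat.card κ ^ σ.partition.parts.card := by
  simp only [mem_fiberStabilizer_iff_factorsThrough]
  rw [card_factorsThrough (cycleThrough_surjective σ), Nat.card_fun, Nat.card_sum,
    Perm.parts_partition, Multiset.card_add, Multiset.card_replicate, Perm.cycleType_def,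
    Multiset.card_map, Nat.card_eq_finsetCard, Nat.card_eq_fintype_card (α := {i // i ∉ σ.support}),
    Fintype.card_subtype_compl, Fintype.card_coe, Finset.card_def]

variable {n : ℕ}

theorem card_invariant_fun_fin (σ : Perm (Fin n)) (k : ℕ) :
    Nat.card {f : Fin n → Fin k // σ ∈ fiberStabilizer f} = k ^ numCycles σ := by
  rw [card_invariant_fun, Nat.card_fin, numCycles]

theorem numCycles_eq (σ : Perm (Fin n)) :
    numCycles σ = σ.cycleType.card + (n - σ.support.card) := by
  simp [numCycles, Perm.parts_partition]

theorem numCycles_one : numCycles (1 : Perm (Fin n)) = n := by simp [numCycles_eq]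

theorem numCycles_le (σ : Perm (Fin n)) : numCycles σ ≤ n := by
  simpa [numCycles, σ.partition.parts_sum] using
    Multiset.card_nsmul_le_sum (a := 1) fun _ hp => σ.partition.parts_pos hp

theorem numCycles_conj (σ τ : Perm (Fin n)) : numCycles (τ * σ * τ⁻¹) = numCycles σ := by
  rw [numCycles, numCycles, ← Perm.partition_eq_of_isConj.mp (isConj_iff.mpr ⟨τ, rfl⟩)]

theorem neg_one_pow_sub_numCycles (σ : Perm (Fin n)) :
    (-1 : ℤˣ) ^ (n - numCycles σ) = Perm.sign σ := by
  have hle := numCycles_le σ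
  have hsupport : σ.support.card ≤ n := by simpa using σ.support.card_le_univ
  have hν := numCycles_eq σ
  rw [Perm.sign_of_cycleType, Perm.sum_cycleType,
    show σ.support.card + σ.cycleType.card = (n - numCycles σ) + 2 * σ.cycleType.card by omega,
    pow_add, pow_mul, neg_one_sq, one_pow, mul_one]

theorem numCycles_mul_swap {σ : Perm (Fin n)} {i m : Fin n} (hm : σ m = m) (him : i ≠ m) :
    numCycles (σ * swap i m) + 1 = numCycles σ := by
  have hcard := Nat.card_congr (invariantFunEquivProd (Fin 2) hm him)
  rw [Nat.card_prod, card_invariant_fun_fin, card_invariant_fun_fin, Nat.card_fin,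
    ← pow_succ] at hcard
  exact (Nat.pow_right_injective le_rfl hcard).symm

end Cycles

/-! ### Jucys–Murphy elements -/

section Eigenvalues

variable {K V A : Type*} [Field K] [AddCommGroup V] [Module K V] [FiniteDimensional K V]
  [Ring A] [Algebra K A] [FiniteDimensional K A]

open Module.End in
theorem exists_common_hasEigenvector [IsAlgClosed K] {f g : Module.End K V} {z : K}
    (hfg : Commute f g) (hz : g.HasEigenvalue z) :
    ∃ c w, f.HasEigenvector c w ∧ g.HasEigenvector z w := by
  have hmaps : Set.MapsTo f (g.eigenspace z) (g.eigenspace z) :=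
    mapsTo_genEigenspace_of_comm hfg.symm z 1
  have : Nontrivial (g.eigenspace z) := (Submodule.nontrivial_iff_ne_bot).mpr hz
  obtain ⟨c, hc⟩ := exists_eigenvalue (f.restrict hmaps)
  obtain ⟨⟨w, hwz⟩, hw, hw0⟩ := hc.exists_hasEigenvector
  have hw0 : w ≠ 0 := fun h => hw0 (Subtype.ext h)
  exact ⟨c, w, ⟨mem_eigenspace_iff.mpr (congrArg Subtype.val (mem_eigenspace_iff.mp hw)), hw0⟩,
    hwz, hw0⟩

open Module.End in
theorem exists_hasEigenvalue_of_mul_eq_mul_sub_one [IsAlgClosed K] {f g s : Module.End K V} {z : K}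
    (hfg : Commute f g) (hs : s * s = 1) (hfs : f * s = s * g - 1) (hz : g.HasEigenvalue z) :
    ∃ c, f.HasEigenvalue c ∧ (z = c ∨ z = c - 1 ∨ z = c + 1) := by
  obtain ⟨c, w, hfw, hgw⟩ := exists_common_hasEigenvector hfg hz
  have hssw : s (s w) = w := by rw [← Module.End.mul_apply, hs, one_apply]
  have hfsw : f (s w) = z • s w - w := by
    rw [← Module.End.mul_apply, hfs, LinearMap.sub_apply, Module.End.mul_apply,
      hgw.apply_eq_smul, map_smul, one_apply]
  have hfv : f ((c - z) • s w + w) = z • ((c - z) • s w + w) := by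
    rw [map_add, map_smul, hfsw, hfw.apply_eq_smul]
    module
  by_cases hv : (c - z) • s w + w = 0
  · have hsv : (c - z) • w + s w = 0 := by simpa [hssw] using congrArg s hv
    have hsq : ((z - (c - 1)) * (z - (c + 1))) • w = 0 := by
      linear_combination (norm := module) (c - z) • hsv - hv
    rcases mul_eq_zero.mp ((smul_eq_zero.mp hsq).resolve_right hfw.2) with h | h
    · exact ⟨c, hasEigenvalue_of_hasEigenvector hfw, .inr (.inl (sub_eq_zero.mp h))⟩
    · exact ⟨c, hasEigenvalue_of_hasEigenvector hfw, .inr (.inr (sub_eq_zero.mp h))⟩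
  · exact ⟨z, hasEigenvalue_of_hasEigenvector ⟨mem_eigenspace_iff.mpr hfv, hv⟩, .inl rfl⟩

theorem hasEigenvalue_lmul_iff {x : A} {z : K} :
    (Algebra.lmul K A x).HasEigenvalue z ↔ z ∈ spectrum K x := by
  rw [Module.End.hasEigenvalue_iff_mem_spectrum, spectrum.mem_iff, spectrum.mem_iff,
    ← AlgHom.commutes (Algebra.lmul K A), ← map_sub, Algebra.lmul_isUnit_iff]

theorem exists_mem_spectrum_of_mul_eq_mul_sub_one [IsAlgClosed K] {x y s : A} {z : K}
    (hxy : Commute x y) (hs : s * s = 1) (hxs : x * s = s * y - 1) (hz : z ∈ spectrum K y) :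
    ∃ c ∈ spectrum K x, z = c ∨ z = c - 1 ∨ z = c + 1 := by
  simp only [← hasEigenvalue_lmul_iff] at hz ⊢
  exact exists_hasEigenvalue_of_mul_eq_mul_sub_one (hxy.map (Algebra.lmul K A))
    (s := Algebra.lmul K A s) (by rw [← map_mul, hs, map_one])
    (by rw [← map_mul, hxs, map_sub, map_mul, map_one]) hz

end Eigenvalues

section JucysMurphy

variable {n : ℕ}

/-- The group algebra of the symmetric group of `{0, …, n - 1}`. -/
abbrev PermAlg (n : ℕ) : Type := MonoidAlgebra ℂ (Perm (Fin n))

instance : Module.Finite ℂ (PermAlg n) :=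
  Module.Finite.of_basis (MonoidAlgebra.basis (Perm (Fin n)) ℂ)

/-- The Jucys–Murphy element `∑_{i < k} (i k)`. -/
noncomputable def jucysMurphy (k : Fin n) : PermAlg n :=
  ∑ i ∈ Finset.Iio k, single (swap i k) 1

theorem commute_single_jucysMurphy {k : Fin n} {σ : Perm (Fin n)} (hk : σ k = k)
    (hσ : ∀ i, σ i < k ↔ i < k) : Commute (single σ 1) (jucysMurphy k) := by
  rw [Commute, SemiconjBy, jucysMurphy, Finset.mul_sum, Finset.sum_mul]
  refine Finset.sum_equiv σ (fun i => by simp [hσ]) fun i _ => ?_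
  rw [single_mul_single, single_mul_single, mul_swap_eq_swap_mul, hk]

theorem commute_jucysMurphy {k l : Fin n} (hkl : k < l) :
    Commute (jucysMurphy k) (jucysMurphy l) := by
  refine Commute.sum_left _ _ _ fun i hi => ?_
  have hi : i < k := Finset.mem_Iio.mp hi
  refine commute_single_jucysMurphy (swap_apply_of_ne_of_ne (hi.trans hkl).ne' hkl.ne') fun j => ?_
  rw [swap_apply_def]
  split_ifs with hji hjk
  · simp [hji, hkl, hi.trans hkl]
  · simp [hjk, hkl, hi.trans hkl]
  · rfl

theorem jucysMurphy_mul_single_swap {k l : Fin n} (hkl : k ⋖ l) :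
    jucysMurphy k * single (swap k l) 1 = single (swap k l) 1 * jucysMurphy l - 1 := by
  have hIio : Finset.Iio l = insert k (Finset.Iio k) := by
    rw [Finset.Iio_insert]
    exact Finset.coe_injective (by simpa using hkl.Iio_eq)
  rw [eq_sub_iff_add_eq, jucysMurphy, jucysMurphy, hIio,
    Finset.sum_insert Finset.notMem_Iio_self, mul_add, single_mul_single, swap_mul_self, one_mul,
    add_comm, Finset.mul_sum, Finset.sum_mul]
  refine congrArg₂ (· + ·) rfl (Finset.sum_congr rfl fun i hi => ?_)
  have hi : i < k := Finset.mem_Iio.mp hi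
  rw [single_mul_single, single_mul_single, mul_swap_eq_swap_mul (swap k l) i l,
    swap_apply_of_ne_of_ne hi.ne (hi.trans hkl.lt).ne, swap_apply_right]

theorem exists_int_of_mem_spectrum_jucysMurphy {k : ℕ} (hk : k < n) {z : ℂ}
    (hz : z ∈ spectrum ℂ (jucysMurphy ⟨k, hk⟩)) : ∃ j : ℤ, |j| ≤ k ∧ z = j := by
  induction k generalizing z with
  | zero =>
    have hzero : jucysMurphy (⟨0, hk⟩ : Fin n) = 0 :=
      Finset.sum_eq_zero fun i hi => absurd (Finset.mem_Iio.mp hi) (Nat.not_lt_zero i)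
    rw [hzero, spectrum.zero_eq, Set.mem_singleton_iff] at hz
    exact ⟨0, by simp [hz]⟩
  | succ k ih =>
    have hcovBy : (⟨k, by omega⟩ : Fin n) ⋖ ⟨k + 1, hk⟩ := by simp [Fin.covBy_iff]
    obtain ⟨c, hc, hzc⟩ := exists_mem_spectrum_of_mul_eq_mul_sub_one
      (commute_jucysMurphy hcovBy.lt) (by simp [MonoidAlgebra.one_def, Perm.one_def])
      (jucysMurphy_mul_single_swap hcovBy) hz
    obtain ⟨j, hj, rfl⟩ := ih _ hc
    rw [abs_le] at hj
    rcases hzc with rfl | rfl | rfl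
    · exact ⟨j, by rw [abs_le]; omega, rfl⟩
    · exact ⟨j - 1, by rw [abs_le]; omega, by simp⟩
    · exact ⟨j + 1, by rw [abs_le]; omega, by simp⟩

theorem isUnit_one_add_smul_jucysMurphy {α : ℂ} (k : Fin n)
    (hα : ∀ j : ℤ, |j| ≤ k → 1 + α * j ≠ 0) : IsUnit (1 + α • jucysMurphy k) := by
  rcases eq_or_ne α 0 with rfl | hα0
  · simp
  have hspec : -α⁻¹ ∉ spectrum ℂ (jucysMurphy k) := fun hz => by
    obtain ⟨j, hj, hαj⟩ := exists_int_of_mem_spectrum_jucysMurphy k.2 hz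
    exact hα j hj (by rw [← hαj, mul_neg, mul_inv_cancel₀ hα0, add_neg_cancel])
  have hunit := (IsUnit.mk0 (-α) (neg_ne_zero.mpr hα0)).map (algebraMap ℂ (PermAlg n))
  have hfactor : 1 + α • jucysMurphy k
      = algebraMap ℂ _ (-α) * (algebraMap ℂ _ (-α⁻¹) - jucysMurphy k) := by
    rw [mul_sub, ← map_mul, neg_mul_neg, mul_inv_cancel₀ hα0, map_one, ← Algebra.smul_def,
      neg_smul, sub_neg_eq_add]
  exact hfactor ▸ hunit.mul (spectrum.notMem_iff.mp hspec)

end JucysMurphy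

section AlphaElt

variable {n : ℕ}

/-- The counterpart `∑_σ α^{n - ν(σ)} σ` of the `α`-determinant in the group algebra. -/
noncomputable def alphaElt (n : ℕ) (α : ℂ) : PermAlg n :=
  ∑ σ : Perm (Fin n), α ^ (n - numCycles σ) • single σ 1

theorem commute_alphaElt (α : ℂ) (x : PermAlg n) : Commute x (alphaElt n α) := by
  induction x using MonoidAlgebra.induction_linear with
  | zero => exact .zero_left _
  | add x y hx hy => exact hx.add_left hy
  | single τ c =>
    rw [← mul_one c, ← smul_eq_mul, ← smul_single]
    refine Commute.smul_left ?_ c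
    rw [Commute, SemiconjBy, alphaElt, Finset.mul_sum, Finset.sum_mul]
    refine Fintype.sum_equiv (MulAut.conj τ).toEquiv _ _ fun σ => ?_
    simp only [MulEquiv.toEquiv_eq_coe, EquivLike.coe_coe, MulAut.conj_apply, numCycles_conj,
      mul_smul_comm, smul_mul_assoc, single_mul_single, mul_one, inv_mul_cancel_right]

/-- The permutations of `{0, …, n - 1}` that move only letters less than `m`. -/
def permsBelow (n m : ℕ) : Finset (Perm (Fin n)) := {σ | ∀ i : Fin n, m ≤ i → σ i = i}

theorem mem_permsBelow {m : ℕ} {σ : Perm (Fin n)} :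
    σ ∈ permsBelow n m ↔ ∀ i : Fin n, m ≤ i → σ i = i := by
  simp [permsBelow]

theorem mem_permsBelow_iff_succ {m : Fin n} {σ : Perm (Fin n)} :
    σ ∈ permsBelow n m ↔ σ ∈ permsBelow n (m + 1) ∧ σ m = m := by
  simp only [mem_permsBelow]
  refine ⟨fun h => ⟨fun i hi => h i (by omega), h m le_rfl⟩, fun ⟨h, hm⟩ i hi => ?_⟩
  rcases hi.eq_or_lt with hi | hi
  · rwa [← Fin.ext hi]
  · exact h i hi

theorem mul_swap_mem_permsBelow {m i : Fin n} (hi : i ≤ m) {σ : Perm (Fin n)}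
    (hσ : σ ∈ permsBelow n (m + 1)) : σ * swap i m ∈ permsBelow n (m + 1) := by
  refine mem_permsBelow.mpr fun j hj => ?_
  rw [Perm.mul_apply, swap_apply_of_ne_of_ne, mem_permsBelow.mp hσ j hj]
  · rintro rfl
    omega
  · rintro rfl
    omega

theorem symm_apply_le_of_mem_permsBelow {m : Fin n} {σ : Perm (Fin n)}
    (hσ : σ ∈ permsBelow n (m + 1)) : σ.symm m ≤ m := by
  by_contra! hlt
  have hfix := mem_permsBelow.mp hσ (σ.symm m) hlt
  rw [apply_symm_apply] at hfix
  exact hlt.ne hfix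

theorem sum_permsBelow_succ {M : Type*} [AddCommMonoid M] (F : Perm (Fin n) → M) (m : Fin n) :
    ∑ σ ∈ permsBelow n (m + 1), F σ
      = ∑ σ ∈ permsBelow n m, ∑ i ∈ Finset.Iic m, F (σ * swap i m) := by
  rw [← Finset.sum_product']
  refine Finset.sum_nbij' (fun τ => (τ * swap (τ.symm m) m, τ.symm m)) (fun p => p.1 * swap p.2 m)
    (fun τ hτ => ?_) (fun p hp => ?_) (fun τ _ => by simp [mul_assoc]) (fun p hp => ?_)
    (fun τ _ => by simp [mul_assoc])
  · have hle := symm_apply_le_of_mem_permsBelow hτ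
    exact Finset.mem_product.mpr ⟨mem_permsBelow_iff_succ.mpr
      ⟨mul_swap_mem_permsBelow hle hτ, by simp⟩, Finset.mem_Iic.mpr hle⟩
  · obtain ⟨hσ, hi⟩ := Finset.mem_product.mp hp
    exact mul_swap_mem_permsBelow (Finset.mem_Iic.mp hi) (mem_permsBelow_iff_succ.mp hσ).1
  · have hm := (mem_permsBelow_iff_succ.mp (Finset.mem_product.mp hp).1).2
    have hsymm : (p.1 * swap p.2 m).symm m = p.2 := by simp [symm_apply_eq, hm]
    exact Prod.ext (by simp only [hsymm, mul_assoc, swap_mul_self, mul_one]) hsymm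

/-- The part of `alphaElt n α` supported on the permutations of the letters less than `m`. -/
noncomputable def alphaPartial (n : ℕ) (α : ℂ) (m : ℕ) : PermAlg n :=
  ∑ σ ∈ permsBelow n m, α ^ (n - numCycles σ) • single σ 1

theorem alphaPartial_zero (α : ℂ) : alphaPartial n α 0 = 1 := by
  have hone : permsBelow n 0 = {1} := by
    ext σ
    simp [mem_permsBelow, Perm.ext_iff]
  simp [alphaPartial, hone, numCycles_one, MonoidAlgebra.one_def]

theorem alphaPartial_self (α : ℂ) : alphaPartial n α n = alphaElt n α := by
  have huniv : permsBelow n n = Finset.univ :=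
    Finset.eq_univ_of_forall fun σ => mem_permsBelow.mpr fun i hi => absurd i.2 (by omega)
  rw [alphaPartial, huniv, alphaElt]

theorem alphaPartial_succ (α : ℂ) (m : Fin n) :
    alphaPartial n α (m + 1) = alphaPartial n α m * (1 + α • jucysMurphy m) := by
  rw [alphaPartial, sum_permsBelow_succ, alphaPartial, Finset.sum_mul]
  refine Finset.sum_congr rfl fun σ hσ => ?_
  rw [← Finset.Iio_insert, Finset.sum_insert Finset.notMem_Iio_self, swap_self,
    ← Perm.one_def, mul_one, mul_add, mul_one, jucysMurphy, Finset.smul_sum, Finset.mul_sum]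
  refine congrArg₂ (· + ·) rfl (Finset.sum_congr rfl fun i hi => ?_)
  have hν := numCycles_mul_swap (mem_permsBelow_iff_succ.mp hσ).2 (Finset.mem_Iio.mp hi).ne
  have hle := numCycles_le σ
  rw [smul_mul_smul_comm, single_mul_single, mul_one, ← pow_succ,
    show n - numCycles (σ * swap i m) = (n - numCycles σ) + 1 by omega]

theorem isUnit_alphaElt {α : ℂ} (hα : ∀ j : ℤ, |j| < n → 1 + α * j ≠ 0) :
    IsUnit (alphaElt n α) := by
  suffices h : ∀ m ≤ n, IsUnit (alphaPartial n α m) from alphaPartial_self α ▸ h n le_rfl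
  intro m hm
  induction m with
  | zero => exact alphaPartial_zero α ▸ isUnit_one
  | succ m ih =>
    rw [alphaPartial_succ α (⟨m, hm⟩ : Fin n)]
    exact (ih (by omega)).mul
      (isUnit_one_add_smul_jucysMurphy _ fun j hj => hα j (hj.trans_lt (by exact_mod_cast hm)))

theorem one_add_mul_intCast_ne_zero {α : ℂ}
    (hα : ∀ k : ℕ, 1 ≤ k → k < n → α ≠ 1 / (k : ℂ) ∧ α ≠ -(1 / (k : ℂ))) (j : ℤ) (hj : |j| < n) :
    1 + α * j ≠ 0 := by
  intro h
  have hj0 : j ≠ 0 := by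
    rintro rfl
    simp at h
  have hα' : α = -(1 / (j : ℂ)) := by
    have : (j : ℂ) ≠ 0 := by exact_mod_cast hj0
    field_simp
    linear_combination h
  obtain ⟨k, rfl | rfl⟩ := j.eq_nat_or_neg
  · exact (hα k (by omega) (by simpa using hj)).2 (by simpa using hα')
  · exact (hα k (by omega) (by simpa using hj)).1 (by simpa using hα')

end AlphaElt

/-! ### Young's lattice and the sum of the squares of the numbers of standard tableaux -/

section YoungLattice

variable {μ : YoungDiagram} {c d x y : ℕ × ℕ}

/-- The box `c` is an outer corner of `μ`: adding it gives a Young diagram. -/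
def Addable (μ : YoungDiagram) (c : ℕ × ℕ) : Prop := c ∉ μ ∧ ∀ d < c, d ∈ μ

/-- The box `c` is an inner corner of `μ`: removing it gives a Young diagram. -/
def Removable (μ : YoungDiagram) (c : ℕ × ℕ) : Prop := c ∈ μ ∧ ∀ d > c, d ∉ μ

/-- The diagram `μ` with the box `c` added. All boxes `d ≤ c` are added along with it, so that
the result is a Young diagram for every `c`; for an addable box they are already in `μ`. -/
def addBox (μ : YoungDiagram) (c : ℕ × ℕ) : YoungDiagram where
  cells := μ.cells ∪ Finset.Iic c
  isLowerSet := by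
    rw [Finset.coe_union, Finset.coe_Iic]
    exact μ.isLowerSet.union (isLowerSet_Iic c)

/-- The diagram `μ` with the box `c` removed. All boxes `d ≥ c` are removed along with it, so that
the result is a Young diagram for every `c`; for a removable box `μ` has no others. -/
def removeBox (μ : YoungDiagram) (c : ℕ × ℕ) : YoungDiagram where
  cells := {d ∈ μ.cells | ¬ c ≤ d}
  isLowerSet := fun a b hba ha => by
    simp only [Finset.coe_filter, Set.mem_ofPred_eq] at ha ⊢
    exact ⟨μ.isLowerSet hba ha.1, fun hcb => ha.2 (hcb.trans hba)⟩

theorem cells_addBox (h : Addable μ c) : (addBox μ c).cells = insert c μ.cells := by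
  ext d
  simp only [addBox, Finset.mem_union, Finset.mem_Iic, Finset.mem_insert, le_iff_eq_or_lt]
  have := h.2 d
  tauto

theorem cells_removeBox (h : Removable μ c) : (removeBox μ c).cells = μ.cells.erase c := by
  ext d
  simp only [removeBox, Finset.mem_filter, Finset.mem_erase, le_iff_eq_or_lt, eq_comm (a := c)]
  have := h.2 d
  tauto

theorem mem_addBox (h : Addable μ c) : d ∈ addBox μ c ↔ d = c ∨ d ∈ μ := by
  simp only [← YoungDiagram.mem_cells, cells_addBox h, Finset.mem_insert]

theorem mem_removeBox (h : Removable μ c) : d ∈ removeBox μ c ↔ d ≠ c ∧ d ∈ μ := by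
  simp only [← YoungDiagram.mem_cells, cells_removeBox h, Finset.mem_erase]

theorem card_addBox (h : Addable μ c) : (addBox μ c).card = μ.card + 1 := by
  rw [YoungDiagram.card, cells_addBox h, Finset.card_insert_of_notMem h.1]

theorem card_removeBox (h : Removable μ c) : (removeBox μ c).card + 1 = μ.card := by
  rw [YoungDiagram.card, cells_removeBox h, Finset.card_erase_add_one h.1]

theorem removable_addBox_self (h : Addable μ c) : Removable (addBox μ c) c := by
  refine ⟨(mem_addBox h).mpr (.inl rfl), fun d hd hdμ => ?_⟩
  exact h.1 (μ.isLowerSet hd.le (((mem_addBox h).mp hdμ).resolve_left hd.ne'))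

theorem addable_removeBox_self (h : Removable μ c) : Addable (removeBox μ c) c :=
  ⟨fun hc => ((mem_removeBox h).mp hc).1 rfl,
    fun _ hd => (mem_removeBox h).mpr ⟨hd.ne, μ.isLowerSet hd.le h.1⟩⟩

theorem removeBox_addBox_self (h : Addable μ c) : removeBox (addBox μ c) c = μ :=
  YoungDiagram.ext (by
    rw [cells_removeBox (removable_addBox_self h), cells_addBox h, Finset.erase_insert h.1])

theorem addBox_removeBox_self (h : Removable μ c) : addBox (removeBox μ c) c = μ :=
  YoungDiagram.ext (by
    rw [cells_addBox (addable_removeBox_self h), cells_removeBox h, Finset.insert_erase h.1])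

theorem removable_addBox_iff (hx : Addable μ x) (hyx : y ≠ x) :
    Removable (addBox μ x) y ↔ Removable μ y ∧ ¬ y < x := by
  simp only [Removable, mem_addBox hx, hyx, false_or, not_or, gt_iff_lt]
  exact ⟨fun ⟨hy, h⟩ => ⟨⟨hy, fun d hd => (h d hd).2⟩, fun hlt => (h x hlt).1 rfl⟩,
    fun ⟨⟨hy, h⟩, hlt⟩ => ⟨hy, fun d hd => ⟨fun hdx => hlt (hdx ▸ hd), h d hd⟩⟩⟩

theorem addable_removeBox_iff (hy : Removable μ y) (hxy : x ≠ y) :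
    Addable (removeBox μ y) x ↔ Addable μ x ∧ ¬ y < x := by
  simp only [Addable, mem_removeBox hy, not_and, ne_eq, hxy, not_false_eq_true, forall_const]
  exact ⟨fun ⟨hx, h⟩ => ⟨⟨hx, fun d hd => (h d hd).2⟩, fun hlt => (h y hlt).1 rfl⟩,
    fun ⟨⟨hx, h⟩, hlt⟩ => ⟨hx, fun d hd => ⟨fun hdy => hlt (hdy ▸ hd), h d hd⟩⟩⟩

theorem removeBox_addBox_comm (hx : Addable μ x) (hy : Removable μ y) (hyx : ¬ y < x) :
    removeBox (addBox μ x) y = addBox (removeBox μ y) x := by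
  have hne : x ≠ y := by
    rintro rfl
    exact hx.1 hy.1
  refine YoungDiagram.ext ?_
  rw [cells_removeBox ((removable_addBox_iff hx hne.symm).mpr ⟨hy, hyx⟩), cells_addBox hx,
    cells_addBox ((addable_removeBox_iff hy hne).mpr ⟨hx, hyx⟩), cells_removeBox hy,
    Finset.erase_insert_of_ne hne]

theorem removable_iff_rowLen {i j : ℕ} :
    Removable μ (i, j) ↔ j + 1 = μ.rowLen i ∧ μ.rowLen (i + 1) < μ.rowLen i := by
  simp only [Removable, Prod.forall, gt_iff_lt, YoungDiagram.mem_iff_lt_rowLen, Prod.mk_lt_mk]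
  constructor
  · rintro ⟨hmem, h⟩
    have hright := h i (j + 1)
    have hbelow := h (i + 1) j
    omega
  · rintro ⟨hj, hlt⟩
    refine ⟨by omega, fun i' j' h => ?_⟩
    rcases h with ⟨hi, hj'⟩ | ⟨hi, hj'⟩
    · have := μ.rowLen_anti (i + 1) i' hi
      omega
    · have := μ.rowLen_anti i i' hi
      omega

theorem addable_iff_rowLen {i j : ℕ} :
    Addable μ (i, j) ↔ j = μ.rowLen i ∧ ∀ k, i = k + 1 → μ.rowLen i < μ.rowLen k := by
  simp only [Addable, Prod.forall, YoungDiagram.mem_iff_lt_rowLen, Prod.mk_lt_mk]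
  constructor
  · rintro ⟨hmem, h⟩
    have hleft := h i (j - 1)
    refine ⟨by omega, fun k hk => ?_⟩
    have habove := h k j
    omega
  · rintro ⟨rfl, hlt⟩
    refine ⟨lt_irrefl _, fun i' j' h => ?_⟩
    rcases h with ⟨hi, hj'⟩ | ⟨hi, hj'⟩
    · have := hlt (i - 1) (by omega)
      have := μ.rowLen_anti i' (i - 1) (by omega)
      omega
    · have := μ.rowLen_anti i' i hi
      omega

open Classical in
/-- The removable boxes of `μ`. -/
noncomputable def removables (μ : YoungDiagram) : Finset (ℕ × ℕ) := {c ∈ μ.cells | Removable μ c}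

theorem mem_removables : c ∈ removables μ ↔ Removable μ c := by
  classical
  rw [removables, Finset.mem_filter, and_iff_right_iff_imp]
  exact fun h => h.1

/-- The addable boxes of `μ`: one in the first row, and one in the row below each removable box. -/
noncomputable def addables (μ : YoungDiagram) : Finset (ℕ × ℕ) :=
  insert (0, μ.rowLen 0) ((removables μ).image fun c => (c.1 + 1, μ.rowLen (c.1 + 1)))

theorem mem_addables : c ∈ addables μ ↔ Addable μ c := by
  obtain ⟨_ | i, j⟩ := c
  · simp [addables, addable_iff_rowLen]
  · simp only [addables, addable_iff_rowLen, Finset.mem_insert, Finset.mem_image, mem_removables,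
      removable_iff_rowLen, Prod.exists, Prod.mk.injEq]
    constructor
    · rintro (⟨h, -⟩ | ⟨i', j', ⟨-, hlt⟩, hi, rfl⟩)
      · omega
      · obtain rfl : i' = i := by omega
        exact ⟨rfl, fun k hk => by rwa [show k = i' by omega]⟩
    · rintro ⟨rfl, h⟩
      have hlt := h i rfl
      exact .inr ⟨i, μ.rowLen i - 1, ⟨by omega, hlt⟩, rfl, rfl⟩

theorem card_addables (μ : YoungDiagram) : (addables μ).card = (removables μ).card + 1 := by
  rw [addables, Finset.card_insert_of_notMem (by simp), Finset.card_image_of_injOn]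
  rintro ⟨i, j⟩ h ⟨i', j'⟩ h' hrow
  rw [Finset.mem_coe, mem_removables, removable_iff_rowLen] at h h'
  obtain rfl : i = i' := by simpa using congrArg Prod.fst hrow
  rw [Prod.mk.injEq]
  omega

open Classical in
theorem removables_addBox (hx : Addable μ x) :
    removables (addBox μ x) = insert x {y ∈ removables μ | ¬ y < x} := by
  ext y
  rw [Finset.mem_insert, Finset.mem_filter, mem_removables, mem_removables]
  rcases eq_or_ne y x with rfl | hyx
  · simp [removable_addBox_self hx]
  · simp [hyx, removable_addBox_iff hx hyx]

open Classical in
theorem addables_removeBox (hy : Removable μ y) :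
    addables (removeBox μ y) = insert y {x ∈ addables μ | ¬ y < x} := by
  ext x
  rw [Finset.mem_insert, Finset.mem_filter, mem_addables, mem_addables]
  rcases eq_or_ne x y with rfl | hxy
  · simp [addable_removeBox_self hy]
  · simp [hxy, addable_removeBox_iff hy hxy]

section Sums

variable {M : Type*} [AddCommMonoid M]

open Classical in
theorem sum_removables_addBox (φ : YoungDiagram → M) (hx : Addable μ x) :
    ∑ y ∈ removables (addBox μ x), φ (removeBox (addBox μ x) y)
      = φ μ + ∑ y ∈ removables μ with ¬ y < x, φ (addBox (removeBox μ y) x) := by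
  rw [removables_addBox hx, Finset.sum_insert, removeBox_addBox_self hx]
  · refine congrArg (φ μ + ·) (Finset.sum_congr rfl fun y hy => ?_)
    rw [Finset.mem_filter, mem_removables] at hy
    rw [removeBox_addBox_comm hx hy.1 hy.2]
  · rw [Finset.mem_filter, mem_removables]
    exact fun h => hx.1 h.1.1

open Classical in
theorem sum_addables_removeBox (φ : YoungDiagram → M) (hy : Removable μ y) :
    ∑ x ∈ addables (removeBox μ y), φ (addBox (removeBox μ y) x)
      = φ μ + ∑ x ∈ addables μ with ¬ y < x, φ (addBox (removeBox μ y) x) := by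
  rw [addables_removeBox hy, Finset.sum_insert, addBox_removeBox_self hy]
  rw [Finset.mem_filter, mem_addables]
  exact fun h => h.1.1 hy.1

/-- In terms of the operators `U` and `D` that add and remove a box in all possible ways, this is
the relation `D U = U D + 1`. -/
theorem sum_addables_sum_removables (φ : YoungDiagram → M) (μ : YoungDiagram) :
    ∑ x ∈ addables μ, ∑ y ∈ removables (addBox μ x), φ (removeBox (addBox μ x) y)
      = ∑ y ∈ removables μ, ∑ x ∈ addables (removeBox μ y), φ (addBox (removeBox μ y) x)
        + φ μ := by
  classical
  rw [Finset.sum_congr rfl fun x hx => sum_removables_addBox φ (mem_addables.mp hx),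
    Finset.sum_congr rfl fun y hy => sum_addables_removeBox φ (mem_removables.mp hy),
    Finset.sum_add_distrib, Finset.sum_add_distrib, Finset.sum_const, Finset.sum_const,
    card_addables, succ_nsmul, add_right_comm]
  simp only [Finset.sum_filter]
  rw [Finset.sum_comm]

theorem finite_setOf_card_eq (n : ℕ) : {μ : YoungDiagram | μ.card = n}.Finite := by
  refine Set.Finite.of_injOn (f := YoungDiagram.cells) (fun μ hμ => ?_)
    (fun _ _ _ _ => YoungDiagram.ext) ((Finset.range n ×ˢ Finset.range n).powerset.finite_toSet)
  rw [Finset.mem_coe, Finset.mem_powerset]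
  rintro ⟨i, j⟩ hij
  have hrow : μ.rowLen i ≤ μ.card :=
    μ.rowLen_eq_card ▸ Finset.card_le_card (Finset.filter_subset _ _)
  have hcol : μ.colLen j ≤ μ.card :=
    μ.colLen_eq_card ▸ Finset.card_le_card (Finset.filter_subset _ _)
  rw [Set.mem_ofPred_eq] at hμ
  rw [Finset.mem_product, Finset.mem_range, Finset.mem_range, ← hμ]
  exact ⟨(YoungDiagram.mem_iff_lt_colLen.mp hij).trans_le hcol,
    (YoungDiagram.mem_iff_lt_rowLen.mp hij).trans_le hrow⟩

/-- The partitions of `n`. -/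
noncomputable def diagrams (n : ℕ) : Finset YoungDiagram := (finite_setOf_card_eq n).toFinset

theorem mem_diagrams {n : ℕ} : μ ∈ diagrams n ↔ μ.card = n := by simp [diagrams]

theorem diagrams_zero : diagrams 0 = {⊥} := by
  ext μ
  rw [mem_diagrams, Finset.mem_singleton, YoungDiagram.card, Finset.card_eq_zero,
    ← YoungDiagram.cells_bot, YoungDiagram.ext_iff]

theorem sum_diagrams_succ (F : YoungDiagram → YoungDiagram → M) (n : ℕ) :
    ∑ ν ∈ diagrams (n + 1), ∑ y ∈ removables ν, F ν (removeBox ν y)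
      = ∑ μ ∈ diagrams n, ∑ x ∈ addables μ, F (addBox μ x) μ := by
  rw [Finset.sum_sigma', Finset.sum_sigma']
  refine Finset.sum_nbij' (fun p => ⟨removeBox p.1 p.2, p.2⟩) (fun p => ⟨addBox p.1 p.2, p.2⟩)
    ?_ ?_ ?_ ?_ ?_ <;> rintro ⟨μ, c⟩ h <;>
    simp only [Finset.mem_sigma, mem_diagrams, mem_removables, mem_addables] at h ⊢
  · have := card_removeBox h.2
    exact ⟨by omega, addable_removeBox_self h.2⟩
  · have := card_addBox h.2
    exact ⟨by omega, removable_addBox_self h.2⟩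
  · rw [addBox_removeBox_self h.2]
  · rw [removeBox_addBox_self h.2]
  · rw [addBox_removeBox_self h.2]

end Sums

end YoungLattice

section StandardTableaux

variable {μ : YoungDiagram} {y : ℕ × ℕ} {t : ℕ × ℕ → ℕ}

theorem StandardTableau.lt_of_lt (T : StandardTableau μ) {c d : μ.cells}
    (h : (c : ℕ × ℕ) < d) : T.1 c < T.1 d := by
  obtain ⟨⟨i, j⟩, hc⟩ := c
  obtain ⟨⟨i', j'⟩, hd⟩ := d
  have hij : (i, j') ∈ μ.cells := μ.isLowerSet (Prod.mk_le_mk.mpr ⟨h.le.1, le_rfl⟩) hd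
  rcases Prod.mk_lt_mk.mp h with ⟨hi, hj⟩ | ⟨hi, hj⟩
  · refine lt_of_le_of_lt ?_ (T.2.2 ⟨(i, j'), hij⟩ _ rfl hi)
    rcases hj.eq_or_lt with rfl | hj
    · exact le_rfl
    · exact (T.2.1 ⟨(i, j), hc⟩ ⟨(i, j'), hij⟩ rfl hj).le
  · refine lt_of_lt_of_le (T.2.1 ⟨(i, j), hc⟩ ⟨(i, j'), hij⟩ rfl hj) ?_
    rcases hi.eq_or_lt with rfl | hi
    · exact le_rfl
    · exact (T.2.2 ⟨(i, j'), hij⟩ ⟨(i', j'), hd⟩ rfl hi).le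

instance (μ : YoungDiagram) : Finite (StandardTableau μ) := by
  unfold StandardTableau
  infer_instance

/-- Standard tableaux as functions on `ℕ × ℕ` with the entries `1, …, |μ|`, extended by `0` off the
diagram, so that tableaux of different shapes can be compared. -/
structure IsStandardFun (μ : YoungDiagram) (t : ℕ × ℕ → ℕ) : Prop where
  bijOn : Set.BijOn t μ (Set.Icc 1 μ.card)
  strictMonoOn : StrictMonoOn t μ
  eq_zero : ∀ c ∉ μ, t c = 0

open Classical in
/-- The function on `ℕ × ℕ` given by the entries of a standard tableau. -/
noncomputable def StandardTableau.entry (T : StandardTableau μ) (c : ℕ × ℕ) : ℕ :=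
  if h : c ∈ μ.cells then T.1 ⟨c, h⟩ + 1 else 0

theorem StandardTableau.entry_coe (T : StandardTableau μ) (c : μ.cells) :
    T.entry c = T.1 c + 1 :=
  dif_pos c.2

theorem StandardTableau.isStandardFun_entry (T : StandardTableau μ) :
    IsStandardFun μ T.entry where
  bijOn := by
    refine ⟨fun c hc => ?_, fun c hc d hd h => ?_, fun k hk => ?_⟩
    · rw [T.entry_coe ⟨c, hc⟩, Set.mem_Icc]
      omega
    · rw [T.entry_coe ⟨c, hc⟩, T.entry_coe ⟨d, hd⟩, Nat.add_right_cancel_iff] at h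
      exact congrArg Subtype.val (T.1.injective (Fin.ext h))
    · rw [Set.mem_Icc] at hk
      refine ⟨T.1.symm ⟨k - 1, by omega⟩, (T.1.symm _).2, ?_⟩
      rw [T.entry_coe, Equiv.apply_symm_apply]
      exact Nat.sub_add_cancel hk.1
  strictMonoOn c hc d hd h := by
    rw [T.entry_coe ⟨c, hc⟩, T.entry_coe ⟨d, hd⟩]
    exact Nat.succ_lt_succ (T.lt_of_lt h)
  eq_zero _ hc := dif_neg hc

theorem StandardTableau.entry_injective :
    Function.Injective (StandardTableau.entry : StandardTableau μ → ℕ × ℕ → ℕ) := by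
  refine fun T T' h => Subtype.ext (Equiv.ext fun c => Fin.ext ?_)
  have hc := congrFun h c
  rwa [T.entry_coe, T'.entry_coe, Nat.add_right_cancel_iff] at hc

theorem IsStandardFun.exists_entry_eq (ht : IsStandardFun μ t) :
    ∃ T : StandardTableau μ, T.entry = t := by
  have hmem (c : μ.cells) : 1 ≤ t c ∧ t c ≤ μ.card := ht.bijOn.mapsTo c.2
  let g (c : μ.cells) : Fin μ.card := ⟨t c - 1, by have := hmem c; omega⟩
  have hg (c : μ.cells) : (g c : ℕ) + 1 = t c := Nat.sub_add_cancel (hmem c).1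
  have hg_bij : Function.Bijective g := by
    rw [Fintype.bijective_iff_injective_and_card]
    refine ⟨fun c d h => Subtype.ext (ht.bijOn.injOn c.2 d.2 ?_), by simp [YoungDiagram.card]⟩
    rw [← hg, ← hg, h]
  have hg_lt (c d : μ.cells) (h : (c : ℕ × ℕ) < d) : g c < g d := by
    have := ht.strictMonoOn c.2 d.2 h
    rw [← hg, ← hg] at this
    exact Nat.lt_of_succ_lt_succ this
  refine ⟨⟨Equiv.ofBijective g hg_bij,
    fun c d h h' => hg_lt c d (Prod.lt_iff.mpr (.inr ⟨h.le, h'⟩)),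
    fun c d h h' => hg_lt c d (Prod.lt_iff.mpr (.inl ⟨h', h.le⟩))⟩, funext fun c => ?_⟩
  by_cases hc : c ∈ μ.cells
  · exact (StandardTableau.entry_coe _ ⟨c, hc⟩).trans (hg ⟨c, hc⟩)
  · exact (dif_neg hc).trans (ht.eq_zero c hc).symm

theorem bijective_standardTableau_entry (μ : YoungDiagram) :
    Function.Bijective (fun T : StandardTableau μ =>
      (⟨T.entry, T.isStandardFun_entry⟩ : {t // IsStandardFun μ t})) :=
  ⟨fun _ _ h => StandardTableau.entry_injective (congrArg Subtype.val h), fun t =>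
    let ⟨T, hT⟩ := t.2.exists_entry_eq
    ⟨T, Subtype.ext hT⟩⟩

instance (μ : YoungDiagram) : Finite {t // IsStandardFun μ t} :=
  Finite.of_surjective _ (bijective_standardTableau_entry μ).surjective

theorem numStandard_eq_card (μ : YoungDiagram) :
    numStandard μ = Nat.card {t // IsStandardFun μ t} :=
  Nat.card_eq_of_bijective _ (bijective_standardTableau_entry μ)

theorem numStandard_bot : numStandard ⊥ = 1 := by
  rw [numStandard_eq_card, Nat.card_eq_one_iff_unique]
  refine ⟨⟨fun t t' => Subtype.ext (funext fun c => ?_)⟩, ⟨⟨fun _ => 0, ?_⟩⟩⟩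
  · rw [t.2.eq_zero c (by simp), t'.2.eq_zero c (by simp)]
  · constructor <;> simp [StrictMonoOn, YoungDiagram.card, Set.eq_empty_iff_forall_notMem]

theorem coe_eq_insert_removeBox (hy : Removable μ y) :
    (μ : Set (ℕ × ℕ)) = insert y (removeBox μ y : Set (ℕ × ℕ)) := by
  ext c
  by_cases hc : c = y <;> simp [mem_removeBox hy, hc, hy.1]

theorem Icc_one_card_eq_insert (hy : Removable μ y) :
    Set.Icc 1 μ.card = insert μ.card (Set.Icc 1 (removeBox μ y).card) := by
  have := card_removeBox hy
  ext k
  simp only [Set.mem_Icc, Set.mem_insert_iff]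
  omega

theorem IsStandardFun.update (hy : Removable μ y) (ht : IsStandardFun (removeBox μ y) t) :
    IsStandardFun μ (Function.update t y μ.card) := by
  have hcard := card_removeBox hy
  have heq : Set.EqOn t (Function.update t y μ.card) (removeBox μ y) := fun c hc =>
    (Function.update_of_ne ((mem_removeBox hy).mp hc).1 _ _).symm
  constructor
  · rw [coe_eq_insert_removeBox hy, Icc_one_card_eq_insert hy]
    nth_rw 2 [← Function.update_self y μ.card t]
    refine (heq.bijOn_iff.mp ht.bijOn).insert ?_
    rw [Function.update_self, Set.mem_Icc]
    omega
  · intro c hc d hd hcd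
    have hcy : c ≠ y := by
      rintro rfl
      exact hy.2 d hcd hd
    have hc' : c ∈ removeBox μ y := (mem_removeBox hy).mpr ⟨hcy, hc⟩
    rcases eq_or_ne d y with rfl | hdy
    · rw [← heq hc', Function.update_self]
      exact (ht.bijOn.mapsTo hc').2.trans_lt (by omega)
    · have hd' : d ∈ removeBox μ y := (mem_removeBox hy).mpr ⟨hdy, hd⟩
      rw [← heq hc', ← heq hd']
      exact ht.strictMonoOn hc' hd' hcd
  · intro c hc
    have hcy : c ≠ y := by
      rintro rfl
      exact hc hy.1
    rw [Function.update_of_ne hcy]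
    exact ht.eq_zero c fun h => hc ((mem_removeBox hy).mp h).2

theorem IsStandardFun.update_zero (ht : IsStandardFun μ t) (hy : Removable μ y)
    (hty : t y = μ.card) : IsStandardFun (removeBox μ y) (Function.update t y 0) := by
  have hcard := card_removeBox hy
  have hy_mem : y ∉ removeBox μ y := fun h => ((mem_removeBox hy).mp h).1 rfl
  have heq : Set.EqOn t (Function.update t y 0) (removeBox μ y) := fun c hc =>
    (Function.update_of_ne ((mem_removeBox hy).mp hc).1 _ _).symm
  constructor
  · have h := ht.bijOn.sdiff_singleton hy.1
    rw [coe_eq_insert_removeBox hy, hty, Icc_one_card_eq_insert hy,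
      Set.insert_sdiff_self_of_notMem hy_mem,
      Set.insert_sdiff_self_of_notMem (by rw [Set.mem_Icc]; omega)] at h
    exact heq.bijOn_iff.mp h
  · refine StrictMonoOn.congr (ht.strictMonoOn.mono fun c hc => ?_) heq
    exact ((mem_removeBox hy).mp hc).2
  · intro c hc
    rcases eq_or_ne c y with rfl | hcy
    · rw [Function.update_self]
    · rw [Function.update_of_ne hcy]
      exact ht.eq_zero c fun h => hc ((mem_removeBox hy).mpr ⟨hcy, h⟩)

theorem IsStandardFun.exists_removable (ht : IsStandardFun μ t) (hμ : 0 < μ.card) :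
    ∃ y, Removable μ y ∧ t y = μ.card := by
  obtain ⟨y, hy, hty⟩ := ht.bijOn.surjOn (Set.right_mem_Icc.mpr hμ)
  refine ⟨y, ⟨hy, fun d hd hdμ => ?_⟩, hty⟩
  have hlt := ht.strictMonoOn hy hdμ hd
  have hle := (ht.bijOn.mapsTo hdμ).2
  omega

theorem numStandard_eq_sum (hμ : 0 < μ.card) :
    numStandard μ = ∑ y ∈ removables μ, numStandard (removeBox μ y) := by
  let F : (Σ y : removables μ, {t // IsStandardFun (removeBox μ y) t}) → {t // IsStandardFun μ t} :=
    fun p => ⟨Function.update p.2.1 p.1.1 μ.card, p.2.2.update (mem_removables.mp p.1.2)⟩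
  have hF_inj : Function.Injective F := by
    rintro ⟨⟨y, hy⟩, t, ht⟩ ⟨⟨y', hy'⟩, t', ht'⟩ h
    rw [mem_removables] at hy hy'
    have h : Function.update t y μ.card = Function.update t' y' μ.card := congrArg Subtype.val h
    obtain rfl : y = y' := by
      refine (ht'.update hy').bijOn.injOn hy.1 hy'.1 ?_
      rw [Function.update_self, ← h, Function.update_self]
    obtain rfl : t = t' := by
      have hy_mem : y ∉ removeBox μ y := fun hmem => ((mem_removeBox hy).mp hmem).1 rfl
      have ht_zero : Function.update t y 0 = t := by
        rw [← ht.eq_zero y hy_mem, Function.update_eq_self]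
      have ht'_zero : Function.update t' y 0 = t' := by
        rw [← ht'.eq_zero y hy_mem, Function.update_eq_self]
      rw [← ht_zero, ← ht'_zero, ← Function.update_idem, h, Function.update_idem]
    rfl
  have hF_surj : Function.Surjective F := by
    rintro ⟨t, ht⟩
    obtain ⟨y, hy, hty⟩ := ht.exists_removable hμ
    refine ⟨⟨⟨y, mem_removables.mpr hy⟩, _, ht.update_zero hy hty⟩, Subtype.ext ?_⟩
    change Function.update (Function.update t y 0) y μ.card = t
    rw [Function.update_idem, ← hty, Function.update_eq_self]
  simp only [numStandard_eq_card]
  rw [← Nat.card_eq_of_bijective F ⟨hF_inj, hF_surj⟩, Nat.card_sigma, Finset.univ_eq_attach,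
    Finset.sum_attach _ fun y => Nat.card {t // IsStandardFun (removeBox μ y) t}]

theorem sum_addables_numStandard (μ : YoungDiagram) :
    ∑ x ∈ addables μ, numStandard (addBox μ x) = (μ.card + 1) * numStandard μ := by
  induction hm : μ.card using Nat.strong_induction_on generalizing μ with | _ m ih
  calc ∑ x ∈ addables μ, numStandard (addBox μ x)
    _ = ∑ x ∈ addables μ, ∑ y ∈ removables (addBox μ x), numStandard (removeBox (addBox μ x) y) :=
      Finset.sum_congr rfl fun x hx =>
        numStandard_eq_sum (card_addBox (mem_addables.mp hx) ▸ Nat.succ_pos _)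
    _ = ∑ y ∈ removables μ, ∑ x ∈ addables (removeBox μ y), numStandard (addBox (removeBox μ y) x)
          + numStandard μ := sum_addables_sum_removables numStandard μ
    _ = ∑ y ∈ removables μ, m * numStandard (removeBox μ y) + numStandard μ := by
      refine congrArg (· + _) (Finset.sum_congr rfl fun y hy => ?_)
      have hcard := card_removeBox (mem_removables.mp hy)
      rw [ih _ (by omega) _ rfl, hcard, hm]
    _ = m * numStandard μ + numStandard μ := by
      rw [← Finset.mul_sum]
      rcases m.eq_zero_or_pos with rfl | hpos
      · rw [zero_mul, zero_mul]
      · rw [numStandard_eq_sum (hm ▸ hpos)]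
    _ = (m + 1) * numStandard μ := (add_one_mul _ _).symm

theorem sum_numStandard_sq (n : ℕ) : ∑ μ ∈ diagrams n, numStandard μ ^ 2 = n.factorial := by
  induction n with
  | zero => rw [diagrams_zero, Finset.sum_singleton, numStandard_bot, one_pow, Nat.factorial_zero]
  | succ n ih =>
    calc ∑ μ ∈ diagrams (n + 1), numStandard μ ^ 2
      _ = ∑ μ ∈ diagrams (n + 1), ∑ y ∈ removables μ, numStandard μ * numStandard (removeBox μ y) :=
        Finset.sum_congr rfl fun μ hμ => by
          rw [← Finset.mul_sum, ← numStandard_eq_sum (by have := mem_diagrams.mp hμ; omega), sq]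
      _ = ∑ μ ∈ diagrams n, ∑ x ∈ addables μ, numStandard (addBox μ x) * numStandard μ :=
        sum_diagrams_succ (fun μ ν => numStandard μ * numStandard ν) n
      _ = ∑ μ ∈ diagrams n, (n + 1) * numStandard μ ^ 2 :=
        Finset.sum_congr rfl fun μ hμ => by
          rw [← Finset.sum_mul, sum_addables_numStandard, mem_diagrams.mp hμ, mul_assoc, sq]
      _ = (n + 1).factorial := by rw [← Finset.mul_sum, ih, Nat.factorial_succ]

end StandardTableaux

/-! ### Young symmetrizers of standard tableaux in the group algebra -/

section Triangular

theorem eq_zero_of_sum_eq_zero_of_triangular {ι Γ M N : Type*} [Fintype ι] [LinearOrder Γ]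
    [AddCommMonoid M] [AddCommMonoid N] {κ : ι → Γ} (hκ : κ.Injective) {v : ι → M} (p : ι → M →+ N)
    (htri : ∀ i j, κ i < κ j → p j (v i) = 0) (hdiag : ∀ i, p i (v i) = 0 → v i = 0)
    (hv : ∑ i, v i = 0) (i : ι) : v i = 0 := by
  classical
  by_contra hi
  obtain ⟨j, hj, hmax⟩ := Finset.exists_max_image {i | v i ≠ 0} κ
    ⟨i, Finset.mem_filter.mpr ⟨Finset.mem_univ i, hi⟩⟩
  simp only [Finset.mem_filter, Finset.mem_univ, true_and] at hj hmax
  refine hj (hdiag j ?_)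
  rw [← map_zero (p j), ← hv, map_sum, Finset.sum_eq_single j (fun l _ hlj => ?_) (by simp)]
  by_cases hl : v l = 0
  · rw [hl, map_zero]
  · exact htri l j ((hmax l hl).lt_of_ne (hκ.ne hlj))

end Triangular

section Tableaux

variable {n : ℕ}

instance : Finite {μ : YoungDiagram // μ.card = n} := (finite_setOf_card_eq n).to_subtype

noncomputable instance : Fintype {μ : YoungDiagram // μ.card = n} := Fintype.ofFinite _

noncomputable instance (μ : YoungDiagram) : Fintype (StandardTableau μ) := Fintype.ofFinite _

/-- The standard tableaux with `n` boxes, of all shapes. -/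
abbrev Tab (n : ℕ) : Type := Σ μ : {μ : YoungDiagram // μ.card = n}, StandardTableau μ.1

namespace Tab

variable (T : Tab n)

/-- The shape of a tableau. -/
abbrev shape : YoungDiagram := T.1.1

/-- The numbering of the boxes by `Fin n`. -/
def num : T.shape.cells ≃ Fin n := T.2.1.trans (finCongr T.1.2)

/-- The box that contains a given entry. -/
def box (x : Fin n) : ℕ × ℕ := T.num.symm x

/-- The row that contains a given entry. -/
def row (x : Fin n) : ℕ := (T.box x).1

/-- The column that contains a given entry. -/
def col (x : Fin n) : ℕ := (T.box x).2

variable {T}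

theorem box_num (c : T.shape.cells) : T.box (T.num c) = c := by rw [box, symm_apply_apply]

theorem box_injective : T.box.Injective := Subtype.val_injective.comp T.num.symm.injective

theorem box_mem (x : Fin n) : T.box x ∈ T.shape := (T.num.symm x).2

theorem exists_box_eq {c : ℕ × ℕ} (hc : c ∈ T.shape) : ∃ x, T.box x = c :=
  ⟨T.num ⟨c, hc⟩, T.box_num ⟨c, hc⟩⟩

theorem le_of_box_le {x y : Fin n} (h : T.box x ≤ T.box y) : x ≤ y := by
  rcases h.eq_or_lt with h | h
  · exact (T.box_injective h).le
  · have hlt : T.num (T.num.symm x) < T.num (T.num.symm y) := T.2.lt_of_lt h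
    rw [apply_symm_apply, apply_symm_apply] at hlt
    exact hlt.le

theorem eq_of_box_eq {T' : Tab n} (h : T.box = T'.box) : T = T' := by
  obtain ⟨⟨μ, hμ⟩, T⟩ := T
  obtain ⟨⟨ν, hν⟩, T'⟩ := T'
  have hshape (S : Tab n) : (S.shape.cells : Set (ℕ × ℕ)) = Set.range S.box :=
    Set.Subset.antisymm (fun _ hc => exists_box_eq hc) (Set.range_subset_iff.mpr box_mem)
  obtain rfl : μ = ν := YoungDiagram.ext (Finset.coe_injective
    ((hshape ⟨⟨μ, hμ⟩, T⟩).trans (h ▸ (hshape ⟨⟨ν, hν⟩, T'⟩).symm)))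
  have hnum : num ⟨⟨μ, hμ⟩, T⟩ = num ⟨⟨μ, hν⟩, T'⟩ :=
    Equiv.symm_bijective.injective (Equiv.ext fun x => Subtype.ext (congrFun h x))
  congr 1
  exact Subtype.ext (Equiv.ext fun c => (finCongr hμ).injective (Equiv.congr_fun hnum c))

variable (T) in
/-- The entry of the box `c`, and `⊤` if `c` is not in the diagram. -/
noncomputable def label (c : ℕ × ℕ) : WithTop (Fin n) := Function.partialInv T.box c

theorem label_eq_coe_iff {c : ℕ × ℕ} {x : Fin n} : T.label c = x ↔ T.box x = c :=
  T.box_injective.isPartialInv x c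

variable (T) in
/-- The entries of a tableau in the order of reading by rows, to be compared lexicographically. -/
noncomputable def key : Lex (ℕ ×ₗ ℕ → WithTop (Fin n)) := toLex fun c => T.label (ofLex c)

theorem key_injective : Function.Injective (key : Tab n → _) := by
  refine fun T T' h => eq_of_box_eq (funext fun x => ?_)
  have hlabel : T.label (T.box x) = T'.label (T.box x) := congrFun h (toLex (T.box x))
  rw [label_eq_coe_iff.mpr rfl, eq_comm, label_eq_coe_iff] at hlabel
  exact hlabel.symm

theorem exists_pair_of_key_lt {T T' : Tab n} (h : T.key < T'.key) :
    ∃ x y, x ≠ y ∧ T.row x = T.row y ∧ T'.col x = T'.col y := by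
  obtain ⟨c, heq, hlt⟩ := h
  replace heq (d : ℕ × ℕ) (hd : toLex d < c) : T.label d = T'.label d := heq _ hd
  replace hlt : T.label (ofLex c) < T'.label (ofLex c) := hlt
  obtain ⟨x, hx⟩ := WithTop.ne_top_iff_exists.mp hlt.ne_top
  have hxc : T.box x = ofLex c := label_eq_coe_iff.mp hx.symm
  have hle : c ≤ toLex (T'.box x) := by
    by_contra! hgt
    have hx' := label_eq_coe_iff.mp ((heq _ hgt).trans (label_eq_coe_iff.mpr rfl))
    rw [← hx', hxc, toLex_ofLex] at hgt
    exact lt_irrefl _ hgt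
  have hcol : T'.col x < T.col x := by
    by_contra! hge
    have hbox : T.box x ≤ T'.box x := ⟨hxc ▸ Prod.Lex.monotone_fst _ _ hle, hge⟩
    obtain ⟨y, hy⟩ := exists_box_eq (T'.shape.isLowerSet hbox (box_mem x))
    rw [← hx, label_eq_coe_iff.mpr (hy.trans hxc), WithTop.coe_lt_coe] at hlt
    exact hlt.not_ge (le_of_box_le (hy ▸ hbox))
  have hleft : (T.row x, T'.col x) < T.box x := Prod.lt_iff.mpr (.inr ⟨le_rfl, hcol⟩)
  obtain ⟨y, hy⟩ := exists_box_eq (T.shape.isLowerSet hleft.le (box_mem x))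
  have hy' : T'.box y = (T.row x, T'.col x) := by
    have hlex : toLex (T.row x, T'.col x) < c := by
      rw [← toLex_ofLex c, ← hxc]
      exact Prod.Lex.toLex_strictMono hleft
    rw [← label_eq_coe_iff, ← heq _ hlex, label_eq_coe_iff, hy]
  refine ⟨x, y, ?_, (congrArg Prod.fst hy).symm, (congrArg Prod.snd hy').symm⟩
  rintro rfl
  exact hcol.ne (congrArg Prod.snd hy).symm

variable (T)

/-- The row symmetrizer. -/
noncomputable def rowSum : PermAlg n := signedSum 1 (fiberStabilizer T.row)

/-- The column antisymmetrizer. -/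
noncomputable def colSum : PermAlg n := signedSum Perm.sign (fiberStabilizer T.col)

/-- The Young symmetrizer of a tableau. -/
noncomputable def young : PermAlg n := T.rowSum * T.colSum

variable {T}

theorem colSum_mul_rowSum_of_key_lt {T' : Tab n} (h : T.key < T'.key) :
    T'.colSum * T.rowSum = 0 := by
  obtain ⟨x, y, hxy, hrow, hcol⟩ := exists_pair_of_key_lt h
  exact signedSum_fiberStabilizer_mul_eq_zero hcol hrow (by simp [Perm.sign_swap hxy])

theorem young_mul_eq_zero_of_colSum_mul_eq_zero {x : PermAlg n}
    (h : T.colSum * (T.young * x) = 0) : T.young * x = 0 := by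
  rw [young, mul_assoc] at h ⊢
  exact signedSum_mul_signedSum_mul_eq_zero h

theorem young_mul_eq_zero_of_sum_eq_zero {x : Tab n → PermAlg n} (h : ∑ T, T.young * x T = 0)
    (T : Tab n) : T.young * x T = 0 := by
  refine eq_zero_of_sum_eq_zero_of_triangular key_injective
    (fun T => AddMonoidHom.mulLeft T.colSum) (fun T T' hlt => ?_)
    (fun T => young_mul_eq_zero_of_colSum_mul_eq_zero) h T
  rw [AddMonoidHom.coe_mulLeft, young, ← mul_assoc, ← mul_assoc, colSum_mul_rowSum_of_key_lt hlt,
    zero_mul, zero_mul]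

theorem young_mul_rowSum_ne_zero : T.young * T.rowSum ≠ 0 := by
  intro h
  have hdisj : Disjoint (fiberStabilizer T.col) (fiberStabilizer T.row) :=
    disjoint_fiberStabilizer fun _ _ hcol hrow => T.box_injective (Prod.ext hrow hcol)
  refine signedSum_mul_signedSum_ne_zero (R := ℂ) (χ := Perm.sign) (ψ := 1) hdisj ?_
  rw [young, rowSum, colSum, ← mul_one (_ * signedSum 1 _), mul_assoc, mul_assoc] at h
  simpa only [mul_one] using signedSum_mul_signedSum_mul_eq_zero h

variable (T) in
/-- The permutation of the entries that carries a tableau of the same shape to `T`. -/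
def relabel (S : StandardTableau T.shape) : Perm (Fin n) := (num ⟨T.1, S⟩).symm.trans T.num

theorem box_relabel (S : StandardTableau T.shape) (x : Fin n) :
    T.box (T.relabel S x) = box ⟨T.1, S⟩ x := by
  rw [relabel, trans_apply, box_num, box]

theorem young_mul_single_relabel (S : StandardTableau T.shape) :
    T.young * single (T.relabel S) 1 = single (T.relabel S) 1 * young ⟨T.1, S⟩ := by
  have hrow : row ⟨T.1, S⟩ = T.row ∘ T.relabel S :=
    funext fun x => congrArg Prod.fst (box_relabel S x).symm
  have hcol : col ⟨T.1, S⟩ = T.col ∘ T.relabel S :=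
    funext fun x => congrArg Prod.snd (box_relabel S x).symm
  rw [young, young, mul_assoc, colSum, rowSum, rowSum, colSum, hrow, hcol, ← mul_assoc (single _ _),
    single_mul_signedSum_of_conj fun _ => mem_fiberStabilizer_comp_perm, mul_assoc,
    single_mul_signedSum_of_conj fun _ => mem_fiberStabilizer_comp_perm]

theorem linearIndependent_young_mul_single_relabel (T : Tab n) :
    LinearIndependent ℂ fun S : StandardTableau T.shape => T.young * single (T.relabel S) 1 := by
  have hne (S : StandardTableau T.shape) :
      T.young * single (T.relabel S) 1 * rowSum ⟨T.1, S⟩ ≠ 0 := by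
    have hunit : IsUnit (single (T.relabel S) 1 : PermAlg n) :=
      (Group.isUnit (T.relabel S)).map (MonoidAlgebra.of ℂ (Perm (Fin n)))
    rw [young_mul_single_relabel, mul_assoc, ne_eq, hunit.mul_right_eq_zero]
    exact young_mul_rowSum_ne_zero
  rw [Fintype.linearIndependent_iff]
  intro z hz S
  have hS := eq_zero_of_sum_eq_zero_of_triangular
    (κ := fun S => OrderDual.toDual (key ⟨T.1, S⟩))
    (fun S S' h => eq_of_heq (Sigma.mk.inj (key_injective (OrderDual.toDual_inj.mp h))).2)
    (fun S => AddMonoidHom.mulRight (rowSum ⟨T.1, S⟩)) (fun S S' hlt => ?_) (fun S hS => ?_) hz S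
  · refine (smul_eq_zero.mp hS).resolve_right fun h => hne S ?_
    rw [h, zero_mul]
  · rw [AddMonoidHom.mulRight_apply, smul_mul_assoc, young_mul_single_relabel, young, mul_assoc,
      mul_assoc, colSum_mul_rowSum_of_key_lt hlt, mul_zero, mul_zero, smul_zero]
  · rw [AddMonoidHom.mulRight_apply, smul_mul_assoc] at hS
    rw [(smul_eq_zero.mp hS).resolve_right (hne S), zero_smul]

theorem linearIndependent_sigma_young_mul_single_relabel :
    LinearIndependent ℂ fun p : Σ T : Tab n, StandardTableau T.shape =>
      p.1.young * single (p.1.relabel p.2) 1 := by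
  rw [Fintype.linearIndependent_iff]
  rintro z hz ⟨T, S⟩
  rw [Fintype.sum_sigma] at hz
  simp only [← mul_smul_comm, ← Finset.mul_sum] at hz
  have hT := young_mul_eq_zero_of_sum_eq_zero hz T
  simp only [Finset.mul_sum, mul_smul_comm] at hT
  exact Fintype.linearIndependent_iff.mp (linearIndependent_young_mul_single_relabel T)
    (fun S => z ⟨T, S⟩) hT S

theorem card_sigma_standardTableau :
    Fintype.card (Σ T : Tab n, StandardTableau T.shape) = n.factorial := by
  have hcard (μ : YoungDiagram) : Fintype.card (StandardTableau μ) = numStandard μ :=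
    Nat.card_eq_fintype_card.symm
  rw [Fintype.card_sigma, Fintype.sum_sigma, ← sum_numStandard_sq,
    Finset.sum_subtype (diagrams n) fun _ => mem_diagrams]
  refine Finset.sum_congr rfl fun μ _ => ?_
  rw [Finset.sum_congr rfl fun _ _ => hcard μ.1, Finset.sum_const, Finset.card_univ, hcard,
    smul_eq_mul, sq]

theorem finrank_permAlg : Module.finrank ℂ (PermAlg n) = n.factorial := by
  rw [Module.finrank_eq_card_basis (MonoidAlgebra.basis (Perm (Fin n)) ℂ), Fintype.card_perm,
    Fintype.card_fin]

theorem exists_sum_young_mul_eq (x : PermAlg n) :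
    ∃ y : Tab n → PermAlg n, ∑ T, T.young * y T = x := by
  have hspan := linearIndependent_sigma_young_mul_single_relabel.span_eq_top_of_card_eq_finrank'
    (card_sigma_standardTableau.trans (finrank_permAlg (n := n)).symm)
  obtain ⟨z, hz⟩ :=
    (Submodule.mem_span_range_iff_exists_fun ℂ).mp (hspan ▸ Submodule.mem_top (x := x))
  refine ⟨fun T => ∑ S, z ⟨T, S⟩ • single (T.relabel S) 1, ?_⟩
  simp only [Finset.mul_sum, mul_smul_comm]
  exact (Fintype.sum_sigma _).symm.trans hz

open Classical in
theorem exists_orthogonal_projections : ∃ y : Tab n → PermAlg n, ∑ T, T.young * y T = 1 ∧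
    ∀ T S : Tab n, T.young * y T * S.young = if T = S then S.young else 0 := by
  obtain ⟨y, hy⟩ := exists_sum_young_mul_eq (1 : PermAlg n)
  refine ⟨y, hy, fun T S => ?_⟩
  have h : ∑ R : Tab n, R.young * (y R * S.young - if R = S then 1 else 0) = 0 := by
    simp only [mul_sub, Finset.sum_sub_distrib, ← mul_assoc, ← Finset.sum_mul, hy, one_mul,
      mul_ite, mul_one, mul_zero, Finset.sum_ite_eq', Finset.mem_univ, if_true, sub_self]
  have hT := young_mul_eq_zero_of_sum_eq_zero h T
  rw [mul_sub, ← mul_assoc, sub_eq_zero] at hT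
  rw [hT]
  split_ifs with hTS
  · rw [hTS, mul_one]
  · rw [mul_zero]

end Tab

end Tableaux

/-! ### The elements of the group algebra at `α = ± 1 / k` -/

section Division

theorem exists_eq_mul_of_commute {K A : Type*} [Field K] [Ring A] [Algebra K A] [Module.Finite K A]
    {a e : A} (hae : Commute a e) (h : ∀ x, a * (e * x) = 0 → e * x = 0) : ∃ y, e = a * y := by
  let I : Submodule K A := LinearMap.range (LinearMap.mulLeft K e)
  have hmaps : ∀ z ∈ I, LinearMap.mulLeft K a z ∈ I := by
    rintro _ ⟨x, rfl⟩
    exact ⟨a * x, (hae.left_comm x).symm⟩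
  have hinj : Function.Injective ((LinearMap.mulLeft K a).restrict hmaps) := by
    rw [injective_iff_map_eq_zero]
    rintro ⟨_, x, rfl⟩ hx
    exact Subtype.ext (h x (congrArg Subtype.val hx))
  obtain ⟨z, hz⟩ := LinearMap.injective_iff_surjective.mp hinj ⟨e, 1, mul_one e⟩
  exact ⟨z, (congrArg Subtype.val hz).symm⟩

end Division

section Special

variable {n k : ℕ} {ε : ℤˣ} {χ ψ : Perm (Fin n) →* ℤˣ} {x : PermAlg n}

theorem sum_signedSum_fiberStabilizer (χ : Perm (Fin n) →* ℤˣ) (k : ℕ) :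
    (∑ f : Fin n → Fin k, signedSum χ (fiberStabilizer f) : PermAlg n) =
      ∑ σ, k ^ numCycles σ • χ σ • single σ 1 := by
  classical
  simp only [signedSum, Finset.sum_filter]
  rw [Finset.sum_comm]
  refine Finset.sum_congr rfl fun σ _ => ?_
  rw [← Finset.sum_filter, Finset.sum_const, ← card_invariant_fun_fin, Nat.card_eq_fintype_card,
    Fintype.card_subtype]

theorem pow_smul_alphaElt (hχ : ∀ σ, ε ^ (n - numCycles σ) = χ σ) (hk : k ≠ 0) :
    (k : ℂ) ^ n • alphaElt n ((ε : ℤ) / k) =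
      ∑ f : Fin n → Fin k, signedSum χ (fiberStabilizer f) := by
  have hk' : (k : ℂ) ≠ 0 := Nat.cast_ne_zero.mpr hk
  rw [sum_signedSum_fiberStabilizer, alphaElt, Finset.smul_sum]
  refine Finset.sum_congr rfl fun σ _ => ?_
  rw [← hχ, smul_smul, Units.smul_def, ← Int.cast_smul_eq_zsmul ℂ, ← Nat.cast_smul_eq_nsmul ℂ,
    smul_smul]
  congr 1
  rw [div_pow, mul_div_assoc', div_eq_iff (pow_ne_zero _ hk'), mul_right_comm]
  push_cast
  rw [← pow_add, Nat.add_sub_cancel' (numCycles_le σ)]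

theorem signedSum_mul_eq_zero_of_alphaElt_mul_eq_zero (hχ : ∀ σ, ε ^ (n - numCycles σ) = χ σ)
    {g : Fin n → ℕ} (hg : ∀ i, g i < k) (hk : k ≠ 0) (h : alphaElt n ((ε : ℤ) / k) * x = 0) :
    signedSum χ (fiberStabilizer g) * x = 0 := by
  have hsum : (∑ f : Fin n → Fin k, signedSum χ (fiberStabilizer f)) * x = 0 := by
    rw [← pow_smul_alphaElt hχ hk, smul_mul_assoc, h, smul_zero]
  have hfib : fiberStabilizer g = fiberStabilizer fun i => (⟨g i, hg i⟩ : Fin k) :=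
    fiberStabilizer_comp_of_injective (f := fun i => (⟨g i, hg i⟩ : Fin k)) Fin.val_injective
  rw [hfib]
  exact signedSum_mul_eq_zero_of_sum_mul_eq_zero hsum _ (Finset.mem_univ _)

theorem alphaElt_mul_signedSum_eq_zero {m : ℕ} {γ : Type*} {g : Fin n → γ} {c : γ}
    (hχ : ∀ σ, ε ^ (n - numCycles σ) = χ σ) (hψ : ∀ i j, i ≠ j → χ (swap i j) = -ψ (swap i j))
    (e : Fin m ↪ Fin n) (he : ∀ a, g (e a) = c) (hkm : k < m) (hk : k ≠ 0) :
    alphaElt n ((ε : ℤ) / k) * signedSum ψ (fiberStabilizer g) = 0 := by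
  have hzero (f : Fin n → Fin k) : (signedSum χ (fiberStabilizer f) *
      signedSum ψ (fiberStabilizer g) : PermAlg n) = 0 := by
    obtain ⟨a, b, hab, hf⟩ := Fintype.exists_ne_map_eq_of_card_lt (f ∘ e) (by simpa using hkm)
    exact signedSum_fiberStabilizer_mul_eq_zero hf ((he a).trans (he b).symm)
      (hψ _ _ (e.injective.ne hab))
  have hkn : (k : ℂ) ^ n ≠ 0 := pow_ne_zero n (Nat.cast_ne_zero.mpr hk)
  refine (smul_eq_zero.mp ?_).resolve_left hkn
  rw [← smul_mul_assoc, pow_smul_alphaElt hχ hk, Finset.sum_mul,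
    Finset.sum_eq_zero fun f _ => hzero f]

namespace Tab

variable {T : Tab n}

theorem row_lt_colLen (i : Fin n) : T.row i < T.shape.colLen 0 :=
  YoungDiagram.mem_iff_lt_colLen.mp (T.shape.up_left_mem le_rfl (Nat.zero_le _) (box_mem i))

theorem col_lt_rowLen (i : Fin n) : T.col i < T.shape.rowLen 0 :=
  YoungDiagram.mem_iff_lt_rowLen.mp (T.shape.up_left_mem (Nat.zero_le _) le_rfl (box_mem i))

theorem rowSum_mul_young : T.rowSum * T.young = Nat.card (fiberStabilizer T.row) • T.young := by
  rw [young, ← mul_assoc, rowSum, signedSum_mul_self, smul_mul_assoc]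

theorem alphaElt_one_div_mul_young_eq_zero (hk : k ≠ 0) (hT : k < T.shape.colLen 0) :
    alphaElt n (1 / k) * T.young = 0 := by
  choose e he using fun a : Fin (T.shape.colLen 0) =>
    exists_box_eq (T := T) (YoungDiagram.mem_iff_lt_colLen.mpr a.2)
  have hinj : e.Injective := fun a b hab =>
    Fin.ext (congrArg Prod.fst ((he a).symm.trans ((congrArg T.box hab).trans (he b))))
  have hcol : alphaElt n (1 / k) * T.colSum = 0 := by
    simpa [colSum] using alphaElt_mul_signedSum_eq_zero (ε := 1) (χ := 1) (fun _ => one_pow _)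
      (fun i j hij => by simp [Perm.sign_swap hij]) ⟨e, hinj⟩
      (fun a => congrArg Prod.snd (he a)) hT hk
  rw [young, (commute_alphaElt _ T.rowSum).symm.left_comm, hcol, mul_zero]

theorem alphaElt_neg_one_div_mul_young_eq_zero (hk : k ≠ 0) (hT : k < T.shape.rowLen 0) :
    alphaElt n (-(1 / k)) * T.young = 0 := by
  choose e he using fun a : Fin (T.shape.rowLen 0) =>
    exists_box_eq (T := T) (YoungDiagram.mem_iff_lt_rowLen.mpr a.2)
  have hinj : e.Injective := fun a b hab =>
    Fin.ext (congrArg Prod.snd ((he a).symm.trans ((congrArg T.box hab).trans (he b))))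
  have hrow : alphaElt n (-(1 / k)) * T.rowSum = 0 := by
    simpa [rowSum, neg_div] using alphaElt_mul_signedSum_eq_zero (ε := -1) (ψ := 1)
      neg_one_pow_sub_numCycles (fun i j hij => by simp [Perm.sign_swap hij]) ⟨e, hinj⟩
      (fun a => congrArg Prod.fst (he a)) hT hk
  rw [young, ← mul_assoc, hrow, zero_mul]

theorem exists_young_eq_alphaElt_one_div_mul (hk : k ≠ 0) (hT : T.shape.colLen 0 ≤ k) :
    ∃ y, T.young = alphaElt n (1 / k) * y := by
  refine exists_eq_mul_of_commute (K := ℂ) (commute_alphaElt _ _).symm fun x hx => ?_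
  have hrow : T.rowSum * (T.young * x) = 0 :=
    signedSum_mul_eq_zero_of_alphaElt_mul_eq_zero (ε := 1) (χ := 1) (fun _ => one_pow _)
      (fun i => (row_lt_colLen i).trans_le hT) hk (by simpa using hx)
  rw [← mul_assoc, rowSum_mul_young, smul_mul_assoc] at hrow
  exact (smul_eq_zero.mp hrow).resolve_left Nat.card_pos.ne'

theorem exists_young_eq_alphaElt_neg_one_div_mul (hk : k ≠ 0) (hT : T.shape.rowLen 0 ≤ k) :
    ∃ y, T.young = alphaElt n (-(1 / k)) * y := by
  refine exists_eq_mul_of_commute (K := ℂ) (commute_alphaElt _ _).symm fun x hx => ?_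
  exact young_mul_eq_zero_of_colSum_mul_eq_zero <|
    signedSum_mul_eq_zero_of_alphaElt_mul_eq_zero (ε := -1) neg_one_pow_sub_numCycles
      (fun i => (col_lt_rowLen i).trans_le hT) hk (by simpa [neg_div] using hx)

end Tab

end Special

/-! ### The group algebra acting on tensors -/

section Action

variable {n : ℕ} {ι κ : Type}

theorem permute_mul (σ τ : Perm ι) : permute n (σ * τ) = permute n τ * permute n σ := by
  refine PiTensorProduct.ext (MultilinearMap.ext fun v => ?_)
  simp only [LinearMap.compMultilinearMap_apply, Module.End.mul_apply, permute_tprod,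
    Perm.mul_apply]

theorem permute_one : permute n (1 : Perm ι) = 1 := by
  refine PiTensorProduct.ext (MultilinearMap.ext fun v => ?_)
  simp only [LinearMap.compMultilinearMap_apply, Module.End.one_apply, permute_tprod,
    Perm.one_apply]

/-- The left action of the group algebra on tensors by permutation of the places. As `permute` is
a right action, a permutation acts through its inverse. -/
noncomputable def act (n : ℕ) (ι : Type) :
    MonoidAlgebra ℂ (Perm ι) →ₐ[ℂ] Module.End ℂ (Tensor n ι) :=
  MonoidAlgebra.lift ℂ _ _
    { toFun σ := permute n σ⁻¹
      map_one' := by rw [inv_one, permute_one]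
      map_mul' σ τ := by rw [mul_inv_rev, permute_mul] }

theorem act_single (σ : Perm ι) : act n ι (single σ 1) = permute n σ⁻¹ := by
  simp [act]

/-- Renaming of the places of a tensor. -/
noncomputable def rename (n : ℕ) (e : ι ≃ κ) : Tensor n ι ≃ₗ[ℂ] Tensor n κ :=
  PiTensorProduct.reindex ℂ (fun _ : ι => (Fin n → ℂ)) e

theorem rename_tprod (e : ι ≃ κ) (v : ι → Fin n → ℂ) :
    rename n e (PiTensorProduct.tprod ℂ v) = PiTensorProduct.tprod ℂ (v ∘ e.symm) :=
  PiTensorProduct.reindex_tprod e v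

theorem rename_permute (e : ι ≃ κ) (σ : Perm ι) (t : Tensor n ι) :
    rename n e (permute n σ t) = permute n (e.permCongr σ) (rename n e t) := by
  suffices h : (rename n e).toLinearMap ∘ₗ permute n σ =
      permute n (e.permCongr σ) ∘ₗ (rename n e).toLinearMap from LinearMap.congr_fun h t
  refine PiTensorProduct.ext (MultilinearMap.ext fun v => ?_)
  simp only [LinearMap.compMultilinearMap_apply, LinearMap.comp_apply, LinearEquiv.coe_coe,
    permute_tprod, rename_tprod, permCongr_apply, Function.comp_def, symm_apply_apply]

variable [Fintype ι] [DecidableEq ι] [Fintype κ] [DecidableEq κ]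

theorem tensorRep_tprod (A : gl n) (v : ι → Fin n → ℂ) :
    tensorRep n ι A (PiTensorProduct.tprod ℂ v) =
      ∑ k, PiTensorProduct.tprod ℂ (Function.update v k (Matrix.toLin' A (v k))) := by
  change (∑ k, PiTensorProduct.map (Pi.mulSingle k (Matrix.toLin' A)))
    (PiTensorProduct.tprod ℂ v) = _
  rw [LinearMap.sum_apply]
  refine Finset.sum_congr rfl fun k _ => ?_
  rw [PiTensorProduct.map_tprod]
  congr 1
  funext l
  rcases eq_or_ne l k with rfl | hl
  · rw [Pi.mulSingle_eq_same, Function.update_self]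
  · rw [Pi.mulSingle_eq_of_ne hl, Function.update_of_ne hl, Module.End.one_apply]

theorem rename_tensorRep (e : ι ≃ κ) (A : gl n) (t : Tensor n ι) :
    rename n e (tensorRep n ι A t) = tensorRep n κ A (rename n e t) := by
  suffices h : (rename n e).toLinearMap ∘ₗ tensorRep n ι A =
      tensorRep n κ A ∘ₗ (rename n e).toLinearMap from LinearMap.congr_fun h t
  refine PiTensorProduct.ext (MultilinearMap.ext fun v => ?_)
  simp only [LinearMap.compMultilinearMap_apply, LinearMap.comp_apply, LinearEquiv.coe_coe,
    rename_tprod, tensorRep_tprod, map_sum]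
  refine Fintype.sum_equiv e _ _ fun k => ?_
  rw [Function.update_comp_equiv, symm_symm, Function.comp_apply, symm_apply_apply]

theorem act_tensorRep (x : MonoidAlgebra ℂ (Perm ι)) (A : gl n) (t : Tensor n ι) :
    act n ι x (tensorRep n ι A t) = tensorRep n ι A (act n ι x t) := by
  induction x using MonoidAlgebra.induction_linear with
  | zero => simp
  | add x y hx hy => rw [map_add, LinearMap.add_apply, LinearMap.add_apply, hx, hy, map_add]
  | single σ c =>
    rw [← mul_one c, ← smul_eq_mul, ← smul_single, map_smul, LinearMap.smul_apply,
      LinearMap.smul_apply, act_single, permute_tensorRep, map_smul]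

/-- The action of an element of the group algebra as an endomorphism of the `gl n`-module of
tensors. -/
noncomputable def actHom (n : ℕ) (x : MonoidAlgebra ℂ (Perm ι)) :
    Tensor n ι →ₗ⁅ℂ,gl n⁆ Tensor n ι where
  toLinearMap := act n ι x
  map_lie' := fun {A t} => act_tensorRep x A t

theorem actHom_mul_apply (x y : MonoidAlgebra ℂ (Perm ι)) (t : Tensor n ι) :
    actHom n (x * y) t = actHom n x (actHom n y t) :=
  LinearMap.congr_fun (map_mul (act n ι) x y) t

open Classical in
theorem act_signedSum (χ : Perm ι →* ℤˣ) (H : Subgroup (Perm ι)) :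
    act n ι (signedSum χ H) = ∑ σ : Perm ι with σ ∈ H, ((χ σ : ℤ) : ℂ) • permute n σ := by
  rw [signedSum, map_sum]
  refine Finset.sum_equiv (Equiv.inv _) (fun σ => by simp) fun σ _ => ?_
  rw [Units.smul_def, map_zsmul, act_single, Equiv.inv_apply, map_inv, Int.units_inv_eq_self]
  exact (Int.cast_smul_eq_zsmul ℂ _ _).symm

theorem rename_act_signedSum {γ : Type*} {χ : Perm ι →* ℤˣ} {ψ : Perm κ →* ℤˣ} (e : ι ≃ κ)
    (hχ : ∀ σ, ψ (e.permCongr σ) = χ σ) (g : κ → γ) (t : Tensor n ι) :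
    rename n e (act n ι (signedSum χ (fiberStabilizer (g ∘ e))) t) =
      act n κ (signedSum ψ (fiberStabilizer g)) (rename n e t) := by
  classical
  simp only [act_signedSum, LinearMap.sum_apply, LinearMap.smul_apply, map_sum, map_smul,
    rename_permute]
  refine Finset.sum_equiv e.permCongr (fun σ => ?_) fun σ _ => by rw [hχ]
  simp only [Finset.mem_filter, Finset.mem_univ, true_and, mem_fiberStabilizer,
    Function.comp_apply, permCongr_apply]
  exact ⟨fun h i => by simpa using h (e.symm i), fun h i => by simpa using h (e i)⟩

theorem youngSymmetrizer_eq_act (μ : YoungDiagram) :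
    youngSymmetrizer n μ =
      act n μ.cells (signedSum 1 (fiberStabilizer fun c : μ.cells => c.1.1) *
        signedSum Perm.sign (fiberStabilizer fun c : μ.cells => c.1.2)) := by
  classical
  rw [youngSymmetrizer, map_mul, act_signedSum, act_signedSum, Finset.sum_mul_sum, Finset.sum_comm]
  refine Finset.sum_congr (Finset.ext fun p => ?_) fun p _ =>
    Finset.sum_congr (Finset.ext fun q => ?_) fun q _ => ?_
  · simp [rowGroup, mem_fiberStabilizer]
  · simp [colGroup, mem_fiberStabilizer]
  · rw [permute_mul, MonoidHom.one_apply, Units.val_one, Int.cast_one, one_smul, mul_smul_comm]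

end Action

section SchurHom

namespace Tab

variable {n : ℕ} (T : Tab n)

theorem rename_youngSymmetrizer (t : Tensor n T.shape.cells) :
    rename n T.num (youngSymmetrizer n T.shape t) = actHom n T.young (rename n T.num t) := by
  have hrow : (fun c : T.shape.cells => c.1.1) = T.row ∘ T.num :=
    funext fun c => congrArg Prod.fst (box_num c).symm
  have hcol : (fun c : T.shape.cells => c.1.2) = T.col ∘ T.num :=
    funext fun c => congrArg Prod.snd (box_num c).symm
  rw [youngSymmetrizer_eq_act, hrow, hcol, map_mul, Module.End.mul_apply,
    rename_act_signedSum (ψ := 1) T.num fun _ => rfl,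
    rename_act_signedSum T.num (Perm.sign_permCongr T.num), young, actHom_mul_apply]
  rfl

/-- The embedding of the Schur module into the tensors of degree `n` given by the numbering `T` of
the boxes. -/
noncomputable def schurHom : schurModule n T.shape →ₗ⁅ℂ,gl n⁆ Tensor n (Fin n) where
  toLinearMap := (rename n T.num).toLinearMap ∘ₗ (schurModule n T.shape).toSubmodule.subtype
  map_lie' := fun {A v} => rename_tensorRep T.num A v.1

theorem schurHom_injective : Function.Injective T.schurHom :=
  (rename n T.num).injective.comp Subtype.val_injective

theorem range_schurHom : T.schurHom.range = (actHom n T.young).range := by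
  ext t
  simp only [LieModuleHom.mem_range]
  constructor
  · rintro ⟨⟨_, s, rfl⟩, rfl⟩
    exact ⟨rename n T.num s, (T.rename_youngSymmetrizer s).symm⟩
  · rintro ⟨w, rfl⟩
    refine ⟨⟨youngSymmetrizer n T.shape ((rename n T.num).symm w), _, rfl⟩, ?_⟩
    refine (T.rename_youngSymmetrizer _).trans ?_
    rw [LinearEquiv.apply_symm_apply]

end Tab

end SchurHom

/-! ### Morphisms from direct sums of Lie modules -/

section DirectSum

variable {R L N Q : Type*} [CommRing R] [LieRing L] [AddCommGroup N] [Module R N]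
  [LieRingModule L N] [AddCommGroup Q] [Module R Q] [LieRingModule L Q]

/-- An injective morphism of Lie modules as an equivalence onto its range. -/
noncomputable def equivRange (f : N →ₗ⁅R,L⁆ Q) (hf : Function.Injective f) :
    N ≃ₗ⁅R,L⁆ f.range :=
  { LinearEquiv.ofInjective (f : N →ₗ[R] Q) hf with
    map_lie' := fun {x m} => Subtype.ext (f.map_lie x m) }

variable {ι : Type*} [DecidableEq ι] {M : ι → Type*} [∀ i, AddCommGroup (M i)]
  [∀ i, Module R (M i)] [∀ i, LieRingModule L (M i)]

/-- The morphism from a direct sum of Lie modules given by morphisms from the summands. -/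
noncomputable def sumHom (f : ∀ i, M i →ₗ⁅R,L⁆ N) : (⨁ i, M i) →ₗ⁅R,L⁆ N where
  toLinearMap := DirectSum.toModule R ι N fun i => f i
  map_lie' := fun {x m} => by
    change DirectSum.toModule R ι N (fun i => f i) ⁅x, m⁆ =
      ⁅x, DirectSum.toModule R ι N (fun i => f i) m⁆
    induction m using DirectSum.induction_on with
    | zero => simp
    | add m m' hm hm' => rw [lie_add, map_add, map_add, lie_add, hm, hm']
    | of i v =>
      have lie_of : ⁅x, DirectSum.of M i v⁆ = DirectSum.lof R ι M i ⁅x, v⁆ :=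
        ((DirectSum.lieModuleOf R ι L M i).map_lie x v).symm
      rw [lie_of, ← DirectSum.lof_eq_of R, DirectSum.toModule_lof, DirectSum.toModule_lof]
      exact (f i).map_lie x v

theorem sumHom_of (f : ∀ i, M i →ₗ⁅R,L⁆ N) (i : ι) (v : M i) :
    sumHom f (DirectSum.of M i v) = f i v :=
  DirectSum.toModule_lof R i v

theorem range_sumHom (f : ∀ i, M i →ₗ⁅R,L⁆ N) : (sumHom f).range = ⨆ i, (f i).range := by
  refine le_antisymm ?_ (iSup_le fun i => ?_)
  · rintro _ ⟨m, rfl⟩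
    induction m using DirectSum.induction_on with
    | zero => simp
    | add m m' hm hm' => rw [map_add]; exact add_mem hm hm'
    | of i v =>
      rw [sumHom_of]
      exact LieSubmodule.mem_iSup_of_mem i ⟨v, rfl⟩
  · rintro _ ⟨v, rfl⟩
    exact ⟨DirectSum.of M i v, sumHom_of f i v⟩

theorem map_sumHom_eq_zero {f : ∀ i, M i →ₗ⁅R,L⁆ N} {p : N →ₗ⁅R,L⁆ Q}
    (hp : ∀ i v, p (f i v) = 0) (m : ⨁ i, M i) : p (sumHom f m) = 0 := by
  induction m using DirectSum.induction_on with
  | zero => simp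
  | add m m' hm hm' => rw [map_add, map_add, hm, hm', add_zero]
  | of i v => rw [sumHom_of, hp]

theorem map_sumHom_eq_map_apply {f : ∀ i, M i →ₗ⁅R,L⁆ N} {p : N →ₗ⁅R,L⁆ Q} {i : ι}
    (hp : ∀ j, j ≠ i → ∀ v, p (f j v) = 0) (m : ⨁ i, M i) :
    p (sumHom f m) = p (f i (m i)) := by
  induction m using DirectSum.induction_on with
  | zero => simp
  | add m m' hm hm' => simp only [map_add, DirectSum.add_apply, hm, hm']
  | of j v =>
    rw [sumHom_of]
    rcases eq_or_ne j i with rfl | hji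
    · rw [DirectSum.of_eq_same]
    · rw [hp j hji, DirectSum.of_eq_of_ne _ _ _ hji.symm, map_zero, map_zero]

end DirectSum

/-! ### The decomposition of the tensors -/

section Decomposition

variable {n : ℕ} (P : YoungDiagram → Prop)

/-- The tableau that indexes a summand of `schurSum n P`, through a numbering of the standard
tableaux of each shape. -/
noncomputable def tabOf (μ : {μ : YoungDiagram // μ.card = n ∧ P μ}) (i : Fin (numStandard μ.1)) :
    Tab n :=
  ⟨⟨μ.1, μ.2.1⟩, (Finite.equivFin (StandardTableau μ.1)).symm i⟩

variable {P}

theorem tabOf_ne_of_ne {μ ν : {μ : YoungDiagram // μ.card = n ∧ P μ}} (h : μ ≠ ν)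
    (i : Fin (numStandard μ.1)) (j : Fin (numStandard ν.1)) : tabOf P μ i ≠ tabOf P ν j :=
  fun he => h (Subtype.ext (congrArg Tab.shape he))

theorem tabOf_injective (μ : {μ : YoungDiagram // μ.card = n ∧ P μ}) :
    Function.Injective (tabOf P μ) := fun _ _ h =>
  (Finite.equivFin (StandardTableau μ.1)).symm.injective (eq_of_heq (Sigma.mk.inj h).2)

theorem exists_tabOf_eq (T : Tab n) (hT : P T.shape) : ∃ μ i, tabOf P μ i = T :=
  ⟨⟨T.shape, T.1.2, hT⟩, Finite.equivFin (StandardTableau T.shape) T.2,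
    congrArg (Sigma.mk T.1) (symm_apply_apply _ _)⟩

variable (P) in
/-- The embedding of a summand of `schurSum n P` into the tensors given by its tableau. -/
noncomputable def tabHom (μ : {μ : YoungDiagram // μ.card = n ∧ P μ})
    (i : Fin (numStandard μ.1)) : schurModule n μ.1 →ₗ⁅ℂ,gl n⁆ Tensor n (Fin n) :=
  (tabOf P μ i).schurHom

theorem range_tabHom (μ : {μ : YoungDiagram // μ.card = n ∧ P μ}) (i : Fin (numStandard μ.1)) :
    (tabHom P μ i).range = (actHom n (tabOf P μ i).young).range :=
  (tabOf P μ i).range_schurHom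

theorem tabHom_injective (μ : {μ : YoungDiagram // μ.card = n ∧ P μ})
    (i : Fin (numStandard μ.1)) : Function.Injective (tabHom P μ i) :=
  (tabOf P μ i).schurHom_injective

variable (n P)

open Classical in
/-- The morphism from the direct sum of Schur modules to the tensors that embeds each summand by
its tableau. -/
noncomputable def schurSumHom : schurSum n P →ₗ⁅ℂ,gl n⁆ Tensor n (Fin n) :=
  sumHom fun μ => sumHom fun i => tabHom P μ i

theorem range_schurSumHom :
    (schurSumHom n P).range = ⨆ (T : Tab n) (_ : P T.shape), (actHom n T.young).range := by
  classical
  rw [schurSumHom, range_sumHom]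
  simp only [range_sumHom, range_tabHom]
  refine le_antisymm (iSup₂_le fun μ i => ?_) (iSup₂_le fun T hT => ?_)
  · exact le_iSup₂_of_le (tabOf P μ i) μ.2.2 le_rfl
  · obtain ⟨μ, i, rfl⟩ := exists_tabOf_eq T hT
    exact le_iSup₂_of_le μ i le_rfl

theorem schurSumHom_injective : Function.Injective (schurSumHom n P) := by
  classical
  obtain ⟨y, -, hy⟩ := Tab.exists_orthogonal_projections (n := n)
  let proj (T : Tab n) := actHom n (T.young * y T)
  have proj_tabHom (T : Tab n) (μ) (i) (v) :
      proj T (tabHom P μ i v) = if T = tabOf P μ i then tabHom P μ i v else 0 := by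
    obtain ⟨w, hw⟩ : tabHom P μ i v ∈ (actHom n (tabOf P μ i).young).range :=
      range_tabHom μ i ▸ ⟨v, rfl⟩
    rw [← hw, ← actHom_mul_apply, hy]
    split_ifs with hT
    · rfl
    · exact LinearMap.congr_fun (map_zero (act n (Fin n))) w
  have proj_schurSumHom (x : schurSum n P) (μ) (i) :
      proj (tabOf P μ i) (schurSumHom n P x) = tabHom P μ i (x μ i) := by
    have proj_shape (ν) (hν : ν ≠ μ) (v) :
        proj (tabOf P μ i) (sumHom (fun j => tabHom P ν j) v) = 0 :=
      map_sumHom_eq_zero (fun j v => by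
        rw [proj_tabHom, if_neg (tabOf_ne_of_ne hν.symm i j)]) v
    have proj_index (j) (hj : j ≠ i) (v) : proj (tabOf P μ i) (tabHom P μ j v) = 0 := by
      rw [proj_tabHom, if_neg ((tabOf_injective μ).ne hj.symm)]
    rw [schurSumHom, map_sumHom_eq_map_apply proj_shape, map_sumHom_eq_map_apply proj_index,
      proj_tabHom, if_pos rfl]
  intro x x' h
  refine DFinsupp.ext fun μ => DFinsupp.ext fun i => tabHom_injective μ i ?_
  exact (proj_schurSumHom x μ i).symm.trans (h ▸ proj_schurSumHom x' μ i)

variable {n P}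

theorem range_actHom_eq_range_schurSumHom {a : PermAlg n} (ha : ∀ x, Commute x a)
    (h0 : ∀ T : Tab n, ¬ P T.shape → a * T.young = 0)
    (h1 : ∀ T : Tab n, P T.shape → ∃ y, T.young = a * y) :
    (actHom n a).range = (schurSumHom n P).range := by
  rw [range_schurSumHom]
  refine le_antisymm ?_ (iSup₂_le fun T hT => ?_)
  · obtain ⟨y, hy, -⟩ := Tab.exists_orthogonal_projections (n := n)
    have sum_act : ∑ T : Tab n, act n (Fin n) (a * T.young * y T) = act n (Fin n) a := by
      simp only [mul_assoc, ← map_sum, ← Finset.mul_sum, hy, mul_one]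
    rintro _ ⟨t, rfl⟩
    change act n (Fin n) a t ∈ _
    rw [← sum_act, LinearMap.sum_apply]
    refine sum_mem fun T _ => ?_
    by_cases hT : P T.shape
    · refine LieSubmodule.mem_iSup_of_mem T (LieSubmodule.mem_iSup_of_mem hT ?_)
      rw [← (ha T.young).eq, mul_assoc]
      exact ⟨actHom n (a * y T) t, (actHom_mul_apply _ _ t).symm⟩
    · rw [h0 T hT, zero_mul, map_zero, LinearMap.zero_apply]
      exact zero_mem _
  · obtain ⟨y, hy⟩ := h1 T hT
    rintro _ ⟨t, rfl⟩
    exact ⟨actHom n y t, by rw [hy, actHom_mul_apply]⟩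

end Decomposition

/-! ### Generation of Lie modules -/

section Generation

variable {R L M N : Type*} [CommRing R] [LieRing L] [AddCommGroup M] [Module R M]

theorem lift_apply_mem [LieAlgebra R L] {ρ : L →ₗ⁅R⁆ Module.End R M} {K : Submodule R M}
    (hK : ∀ x, ∀ m ∈ K, ρ x m ∈ K) (u : UniversalEnvelopingAlgebra R L) {m : M} (hm : m ∈ K) :
    UniversalEnvelopingAlgebra.lift R ρ u m ∈ K := by
  obtain ⟨v, rfl⟩ : ∃ v, UniversalEnvelopingAlgebra.mkAlgHom R L v = u := Quotient.exists_rep u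
  induction v using TensorAlgebra.induction generalizing m with
  | algebraMap r => simpa [Algebra.algebraMap_eq_smul_one] using K.smul_mem r hm
  | ι x =>
    change UniversalEnvelopingAlgebra.lift R ρ (UniversalEnvelopingAlgebra.ι R x) m ∈ K
    rw [UniversalEnvelopingAlgebra.lift_ι_apply]
    exact hK x m hm
  | mul v w hv hw =>
    rw [map_mul, map_mul, Module.End.mul_apply]
    exact hv (hw hm)
  | add v w hv hw =>
    rw [map_add, map_add, LinearMap.add_apply]
    exact K.add_mem (hv hm) (hw hm)

variable [LieRingModule L M] [AddCommGroup N] [Module R N] [LieRingModule L N]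

theorem map_lieSpan (f : M →ₗ⁅R,L⁆ N) (s : Set M) :
    (LieSubmodule.lieSpan R L s).map f = LieSubmodule.lieSpan R L (f '' s) := by
  refine le_antisymm ?_ (LieSubmodule.lieSpan_le.mpr ?_)
  · rw [LieSubmodule.map_le_iff_le_comap, LieSubmodule.lieSpan_le]
    exact fun m hm => LieSubmodule.subset_lieSpan ⟨m, hm, rfl⟩
  · exact Set.image_mono LieSubmodule.subset_lieSpan

theorem cyclicModule_eq_lieSpan (n : ℕ) (α : ℂ) :
    cyclicModule n α =
      LieSubmodule.lieSpan ℂ (gl n) {alphaDet α (Matrix.mvPolynomialX (Fin n) (Fin n) ℂ)} := by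
  refine le_antisymm ?_ (LieSubmodule.lieSpan_le.mpr (Set.singleton_subset_iff.mpr ?_))
  · rintro _ ⟨u, rfl⟩
    exact lift_apply_mem (ρ := rho n) (K := LieSubmodule.toSubmodule _)
      (fun A _ hm => LieSubmodule.lie_mem _ (x := A) hm) u
      (LieSubmodule.subset_lieSpan (Set.mem_singleton _))
  · exact ⟨1, by rw [map_one, Module.End.one_apply]⟩

end Generation

/-! ### The standard basis of the tensors -/

section StandardBasis

variable {n : ℕ}

/-- The standard basis `e_{p 0} ⊗ ⋯ ⊗ e_{p (n - 1)}` of the tensors. -/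
noncomputable def stdBasis (n : ℕ) : Module.Basis (Fin n → Fin n) ℂ (Tensor n (Fin n)) :=
  Basis.piTensorProduct fun _ => Pi.basisFun ℂ (Fin n)

theorem stdBasis_apply (p : Fin n → Fin n) :
    stdBasis n p = PiTensorProduct.tprod ℂ fun j => (Pi.single (p j) 1 : Fin n → ℂ) := by
  rw [stdBasis, Basis.piTensorProduct_apply]
  simp only [Pi.basisFun_apply]

theorem toLin'_single_single (a b c : Fin n) :
    Matrix.toLin' (Matrix.single a c (1 : ℂ)) (Pi.single b 1) =
      if b = c then Pi.single a 1 else 0 := by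
  rw [Matrix.toLin'_apply, Matrix.mulVec_single_one]
  funext i
  split_ifs with h
  · subst h
    simp [Matrix.single_apply, Pi.single_apply, eq_comm]
  · simp [Ne.symm h]

theorem lie_single_stdBasis (a c : Fin n) (p : Fin n → Fin n) :
    ⁅(Matrix.single a c 1 : gl n), stdBasis n p⁆ =
      ∑ k with p k = c, stdBasis n (Function.update p k a) := by
  change tensorRep n (Fin n) (Matrix.single a c 1) (stdBasis n p) = _
  rw [stdBasis_apply, tensorRep_tprod, Finset.sum_filter]
  refine Finset.sum_congr rfl fun k _ => ?_
  rw [toLin'_single_single]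
  split_ifs with hk
  · rw [stdBasis_apply]
    congr 1
    funext l
    rcases eq_or_ne l k with rfl | hl
    · simp only [Function.update_self]
    · simp only [Function.update_of_ne hl]
  · exact MultilinearMap.map_coord_zero _ k (Function.update_self ..)

-- The matrix unit with entry at `(p a, a)` maps `update p a a` to `p` plus tensors with fewer
-- displaced places.
theorem stdBasis_mem_lieSpan_of_forall_notMem (s : Finset (Fin n)) {p : Fin n → Fin n}
    (hp : ∀ i ∉ s, p i = i) : stdBasis n p ∈ LieSubmodule.lieSpan ℂ (gl n) {stdBasis n id} := by
  induction s using Finset.induction_on generalizing p with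
  | empty =>
    rw [show p = id from funext fun i => hp i (Finset.notMem_empty i)]
    exact LieSubmodule.subset_lieSpan (Set.mem_singleton _)
  | insert a s _ ih =>
    let q := Function.update p a a
    have hqa : q a = a := Function.update_self ..
    have hq : ∀ i ∉ s, q i = i := fun i hi => by
      rcases eq_or_ne i a with rfl | hia
      · exact hqa
      · exact (Function.update_of_ne hia _ _).trans (hp i (by simp [hia, hi]))
    have hqp : Function.update q a (p a) = p := by
      rw [Function.update_idem, Function.update_eq_self]
    have hlie := LieSubmodule.lie_mem _ (x := (Matrix.single (p a) a 1 : gl n)) (ih hq)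
    have ha : a ∈ Finset.univ.filter fun k => q k = a := by simpa using hqa
    rw [lie_single_stdBasis, ← Finset.add_sum_erase _ _ ha, hqp] at hlie
    refine (add_mem_cancel_right (sum_mem fun k hk => ih fun i hi => ?_)).mp hlie
    obtain ⟨hka, hqk⟩ : k ≠ a ∧ q k = a := by simpa using hk
    have hik : i ≠ k := by
      rintro rfl
      exact hka ((hq i hi).symm.trans hqk)
    rw [Function.update_of_ne hik, hq i hi]

theorem lieSpan_stdBasis_id : LieSubmodule.lieSpan ℂ (gl n) {stdBasis n id} = ⊤ := by
  rw [← LieSubmodule.toSubmodule_eq_top, eq_top_iff, ← (stdBasis n).span_eq, Submodule.span_le]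
  rintro _ ⟨p, rfl⟩
  exact stdBasis_mem_lieSpan_of_forall_notMem Finset.univ fun i hi => absurd (Finset.mem_univ i) hi

end StandardBasis

/-! ### Tensors as polynomials -/

section Polynomials

variable {n : ℕ}

/-- The linear form with given coefficients in the variables of the column `j`. -/
noncomputable def colForm (j : Fin n) : (Fin n → ℂ) →ₗ[ℂ] Poly n :=
  Fintype.linearCombination ℂ fun i => MvPolynomial.X (i, j)

theorem colForm_single (i j : Fin n) :
    colForm j (Pi.single i 1) = (MvPolynomial.X (i, j) : Poly n) := by
  rw [colForm, Fintype.linearCombination_apply_single, one_smul]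

theorem polyDer_colForm (A : gl n) (j : Fin n) (v : Fin n → ℂ) :
    polyDer A (colForm j v) = colForm j (Matrix.toLin' A v) := by
  simp only [colForm, Fintype.linearCombination_apply, map_sum, Derivation.map_smul, polyDer_X,
    Finset.smul_sum, smul_smul, Matrix.toLin'_apply, Matrix.mulVec, dotProduct, Finset.sum_smul]
  rw [Finset.sum_comm]
  exact Finset.sum_congr rfl fun i _ => Finset.sum_congr rfl fun a _ => by rw [mul_comm]

theorem derivation_prod {R A M ι : Type*} [CommRing R] [CommRing A] [Algebra R A]
    [AddCommGroup M] [Module R M] [Module A M] [DecidableEq ι] (D : Derivation R A M)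
    (s : Finset ι) (f : ι → A) :
    D (∏ i ∈ s, f i) = ∑ k ∈ s, (∏ i ∈ s.erase k, f i) • D (f k) := by
  induction s using Finset.induction_on with
  | empty => simp
  | insert a s ha ih =>
    rw [Finset.prod_insert ha, D.leibniz, ih, Finset.sum_insert ha, Finset.erase_insert ha,
      add_comm, Finset.smul_sum]
    congr 1
    refine Finset.sum_congr rfl fun k hk => ?_
    rw [Finset.erase_insert_of_ne (ne_of_mem_of_not_mem hk ha).symm, Finset.prod_insert
      fun h => ha (Finset.mem_of_mem_erase h), mul_smul]

/-- The linear map from tensors to polynomials that sends `e_{p 0} ⊗ ⋯ ⊗ e_{p (n - 1)}` to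
`∏ j, x (p j) j`. -/
noncomputable def toPolyLin (n : ℕ) : Tensor n (Fin n) →ₗ[ℂ] Poly n :=
  PiTensorProduct.lift ((MultilinearMap.mkPiAlgebra ℂ (Fin n) (Poly n)).compLinearMap colForm)

theorem toPolyLin_tprod (v : Fin n → Fin n → ℂ) :
    toPolyLin n (PiTensorProduct.tprod ℂ v) = ∏ j, colForm j (v j) := by
  rw [toPolyLin, PiTensorProduct.lift.tprod]
  rfl

theorem toPolyLin_tensorRep (A : gl n) (t : Tensor n (Fin n)) :
    toPolyLin n (tensorRep n (Fin n) A t) = polyDer A (toPolyLin n t) := by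
  suffices h : toPolyLin n ∘ₗ tensorRep n (Fin n) A = (polyDer A : Poly n →ₗ[ℂ] Poly n) ∘ₗ
      toPolyLin n from LinearMap.congr_fun h t
  refine PiTensorProduct.ext (MultilinearMap.ext fun v => ?_)
  simp only [LinearMap.compMultilinearMap_apply, LinearMap.comp_apply, Derivation.coeFn_coe,
    tensorRep_tprod, map_sum, toPolyLin_tprod, derivation_prod, polyDer_colForm]
  refine Finset.sum_congr rfl fun k _ => ?_
  rw [← Finset.prod_erase_mul _ _ (Finset.mem_univ k), Function.update_self, smul_eq_mul]
  congr 1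
  refine Finset.prod_congr rfl fun l hl => ?_
  rw [Function.update_of_ne (Finset.ne_of_mem_erase hl)]

/-- `toPolyLin` as a morphism of `gl n`-modules. -/
noncomputable def toPoly (n : ℕ) : Tensor n (Fin n) →ₗ⁅ℂ,gl n⁆ Poly n where
  toLinearMap := toPolyLin n
  map_lie' := fun {A t} => toPolyLin_tensorRep A t

theorem toPoly_stdBasis (p : Fin n → Fin n) :
    toPoly n (stdBasis n p) = ∏ j, (MvPolynomial.X (p j, j) : Poly n) := by
  change toPolyLin n _ = _
  simp only [stdBasis_apply, toPolyLin_tprod, colForm_single]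

theorem sum_single_pair_injective {κ ι : Type*} [Fintype ι] :
    Function.Injective fun p : ι → κ => (∑ j, Finsupp.single (p j, j) 1 : κ × ι →₀ ℕ) := by
  classical
  intro p q h
  have apply_pair (p : ι → κ) (a : κ) (j : ι) :
      (∑ j, Finsupp.single (p j, j) 1 : κ × ι →₀ ℕ) (a, j) = if p j = a then 1 else 0 := by
    rw [Finsupp.finsetSum_apply, Finset.sum_eq_single j (fun k _ hk => ?_) fun hj => ?_]
    · simp [Finsupp.single_apply]
    · simp [hk]
    · exact absurd (Finset.mem_univ j) hj
  funext j
  have h1 := DFunLike.congr_fun h (p j, j)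
  simp only [apply_pair] at h1
  grind

theorem linearIndependent_toPoly_stdBasis :
    LinearIndependent ℂ fun p => toPoly n (stdBasis n p) := by
  have hmonomial : (fun p => toPoly n (stdBasis n p)) =
      MvPolynomial.basisMonomials (Fin n × Fin n) ℂ ∘ fun p => ∑ j, Finsupp.single (p j, j) 1 := by
    funext p
    rw [toPoly_stdBasis, Function.comp_apply, MvPolynomial.coe_basisMonomials]
    exact (MvPolynomial.monomial_sum_one _ _).symm
  rw [hmonomial]
  exact (MvPolynomial.basisMonomials _ ℂ).linearIndependent.comp _ sum_single_pair_injective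

theorem toPoly_injective : Function.Injective (toPoly n) := by
  have linearCombination_repr (t : Tensor n (Fin n)) :
      Finsupp.linearCombination ℂ (fun p => toPoly n (stdBasis n p)) ((stdBasis n).repr t) =
        toPoly n t := by
    conv_rhs => rw [← (stdBasis n).linearCombination_repr t]
    exact (Finsupp.apply_linearCombination ℂ (toPoly n : Tensor n (Fin n) →ₗ[ℂ] Poly n) _ _).symm
  refine fun s t h => (stdBasis n).repr.injective (linearIndependent_toPoly_stdBasis ?_)
  rw [linearCombination_repr, linearCombination_repr, h]

theorem toPoly_actHom_alphaElt (α : ℂ) :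
    toPoly n (actHom n (alphaElt n α) (stdBasis n id)) =
      alphaDet α (Matrix.mvPolynomialX (Fin n) (Fin n) ℂ) := by
  change toPolyLin n (act n (Fin n) (alphaElt n α) (stdBasis n id)) = _
  rw [alphaElt, alphaDet]
  simp only [map_sum, map_smul, LinearMap.sum_apply, LinearMap.smul_apply, act_single,
    stdBasis_apply, permute_tprod, toPolyLin_tprod, colForm_single, Matrix.mvPolynomialX_apply]
  refine Finset.sum_congr rfl fun σ _ => ?_
  congr 1
  refine (Equiv.prod_comp σ _).symm.trans (Finset.prod_congr rfl fun i _ => ?_)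
  simp only [Perm.inv_def, symm_apply_apply, id_eq]

theorem cyclicModule_eq_range (n : ℕ) (α : ℂ) :
    cyclicModule n α = ((toPoly n).comp (actHom n (alphaElt n α))).range := by
  rw [cyclicModule_eq_lieSpan, ← LieModuleHom.map_top, ← lieSpan_stdBasis_id, map_lieSpan,
    Set.image_singleton, LieModuleHom.comp_apply, toPoly_actHom_alphaElt]

theorem nonempty_cyclicModule_equiv {P : YoungDiagram → Prop} {α : ℂ}
    (h0 : ∀ T : Tab n, ¬ P T.shape → alphaElt n α * T.young = 0)
    (h1 : ∀ T : Tab n, P T.shape → ∃ y, T.young = alphaElt n α * y) :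
    Nonempty (cyclicModule n α ≃ₗ⁅ℂ,gl n⁆ schurSum n P) := by
  have hrange : cyclicModule n α = ((toPoly n).comp (schurSumHom n P)).range := by
    rw [cyclicModule_eq_range, ← LieModuleHom.map_top, ← LieModuleHom.map_top,
      LieSubmodule.map_comp, LieSubmodule.map_comp, LieModuleHom.map_top, LieModuleHom.map_top,
      range_actHom_eq_range_schurSumHom (commute_alphaElt α) h0 h1]
  rw [hrange]
  have hinj : Function.Injective ((toPoly n).comp (schurSumHom n P)) :=
    toPoly_injective.comp (schurSumHom_injective n P)
  exact ⟨(equivRange _ hinj).symm⟩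

theorem nonempty_tensor_equiv :
    Nonempty (Tensor n (Fin n) ≃ₗ⁅ℂ,gl n⁆ schurSum n fun _ => True) := by
  have hrange : (schurSumHom n fun _ => True).range = ⊤ := by
    rw [← range_actHom_eq_range_schurSumHom (a := 1) Commute.one_right
      (fun _ hT => absurd trivial hT) fun T _ => ⟨T.young, (one_mul _).symm⟩]
    exact LieModuleHom.range_eq_top _ |>.mpr fun t =>
      ⟨t, LinearMap.congr_fun (map_one (act n (Fin n))) t⟩
  exact ⟨((equivRange _ (schurSumHom_injective n _)).trans
    (hrange ▸ LieModuleEquiv.ofTop ℂ (gl n) (Tensor n (Fin n)))).symm⟩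

end Polynomials

end AlphaDet

theorem theorem1p1 (n : ℕ) :
    (∀ k : ℕ, 1 ≤ k → k < n →
      Nonempty (AlphaDet.cyclicModule n (1 / (k : ℂ)) ≃ₗ⁅ℂ, AlphaDet.gl n⁆
        AlphaDet.schurSum n (fun μ => μ.colLen 0 ≤ k)) ∧
      Nonempty (AlphaDet.cyclicModule n (-(1 / (k : ℂ))) ≃ₗ⁅ℂ, AlphaDet.gl n⁆
        AlphaDet.schurSum n (fun μ => μ.rowLen 0 ≤ k))) ∧
    (∀ α : ℂ, (∀ k : ℕ, 1 ≤ k → k < n → α ≠ 1 / (k : ℂ) ∧ α ≠ -(1 / (k : ℂ))) →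
      Nonempty (AlphaDet.cyclicModule n α ≃ₗ⁅ℂ, AlphaDet.gl n⁆
        AlphaDet.Tensor n (Fin n)) ∧
      Nonempty (AlphaDet.Tensor n (Fin n) ≃ₗ⁅ℂ, AlphaDet.gl n⁆
        AlphaDet.schurSum n (fun _ => True))) := by
  refine ⟨fun k hk _ => ?_, fun α hα => ?_⟩
  · have hk0 : k ≠ 0 := Nat.one_le_iff_ne_zero.mp hk
    exact ⟨AlphaDet.nonempty_cyclicModule_equiv
        (fun _ hT => AlphaDet.Tab.alphaElt_one_div_mul_young_eq_zero hk0 (not_le.mp hT))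
        fun _ hT => AlphaDet.Tab.exists_young_eq_alphaElt_one_div_mul hk0 hT,
      AlphaDet.nonempty_cyclicModule_equiv
        (fun _ hT => AlphaDet.Tab.alphaElt_neg_one_div_mul_young_eq_zero hk0 (not_le.mp hT))
        fun _ hT => AlphaDet.Tab.exists_young_eq_alphaElt_neg_one_div_mul hk0 hT⟩
  · obtain ⟨u, hu⟩ := AlphaDet.isUnit_alphaElt (AlphaDet.one_add_mul_intCast_ne_zero hα)
    obtain ⟨tensorEquiv⟩ := AlphaDet.nonempty_tensor_equiv (n := n)
    obtain ⟨cyclicEquiv⟩ := AlphaDet.nonempty_cyclicModule_equiv (n := n) (α := α)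
      (P := fun _ => True) (fun _ hT => absurd trivial hT)
      fun T _ => ⟨u⁻¹ * T.young, by rw [← hu, Units.mul_inv_cancel_left]⟩
    exact ⟨⟨cyclicEquiv.trans tensorEquiv.symm⟩, ⟨tensorEquiv⟩⟩
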